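/- Let $N\ge 1$, let $\mathcal D\subset\mathbb R^N$ be open, bounded and connected (non-empty), let $F:\mathbb R^N\to\mathbb R$ be bounded and continuous, let $\mathbf p\in(1,\infty)$ and $\epsilon\in(0,1)$. Let $\gamma,a>0$ satisfy $\frac{N+2}{\gamma^2}+a^2=\mathbf p-1$ and the scaling condition $$ (a\le 1 \text{ and } \gamma a>1)\quad\text{or}\quad (a\ge 1\text{ and }\gamma>1). $$ **Dynamic programming principle.** For $\rho,\alpha>0$ and $\nu$ a unit vector or $0$, let $E(x,\rho;\alpha,\nu)=x+\{y:\ \langle y,\nu\rangle^2/\alpha^2+|y-\langle y,\nu\rangle\nu|^2<\rho^2\}$. Put $d_\epsilon(x)=\frac1\epsilon\min\{\epsilon,\mathrm{dist}(x,\mathbb R^N\setminus\mathcal D)\}$ and, for bounded Borel $u:\mathbb R^N\to\mathbb R$, $$ S_\epsilon u(x_0)=\tfrac12\Big(\inf_{x\in B(x_0,\epsilon)}+\sup_{x\in B(x_0,\epsilon)}\Big)\,\frac{1}{|E_x|}\int_{E_x}u(w)\,dw,\qquad E_x=E\Big(x,\gamma\epsilon;\,1+(a-1)\tfrac{|x-x_0|^2}{\epsilon^2},\,\tfrac{x-x_0}{|x-x_0|}\Big),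 $$ where $\frac{x-x_0}{|x-x_0|}$ is read as $0$ for $x=x_0$. The dynamic programming principle (DPP) is the equation $u=d_\epsilon S_\epsilon u+(1-d_\epsilon)F$ on all of $\mathbb R^N$. **The game.** Let $\Omega_1=B(0,1)\times\{1,2\}\times(0,1)$, with the product of the normalised Lebesgue measure on $B(0,1)$, the uniform measure on $\{1,2\}$ and the Lebesgue measure on $(0,1)$. Let $(\Omega,\mathbb P)$ be the countable product of copies of $\Omega_1$, with elements $\omega=\{(w_i,s_i,t_i)\}_{i\ge1}$. A strategy is a sequence of measurable functions $\sigma^n:\mathbb R^N\times(\mathbb R^N\times\Omega_1)^n\to B(0,1)$, $n\ge 0$. Given $x_0\in\mathbb R^N$ and strategies $\sigma_I,\sigma_{II}$ of the two players, set $X_0=x_0$ and, for $n\ge1$, $$ X_n=X_{n-1}+\epsilon\big(y+\gamma w_n+\gamma(a-1)\langle w_n,y\rangle y\big), $$ with $y=\sigma_I^{n-1}(h_{n-1})$ if $s_n=1$ and $y=\sigma_{II}^{n-1}(h_{n-1})$ if $s_n=2$, where $h_{n-1}=\big(x_0,(X_1,w_1,s_1,t_1),\dots,(X_{n-1},w_{n-1},s_{n-1},t_{n-1})\big)$.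 Let $\tau=\min\{n\ge1:\ t_n>d_\epsilon(X_{n-1})\}\in\mathbb N\cup\{\infty\}$. The game values at $x_0$ are $$ u_I^\epsilon(x_0)=\sup_{\sigma_I}\inf_{\sigma_{II}}\mathbb E[F(X_{\tau-1})],\qquad u_{II}^\epsilon(x_0)=\inf_{\sigma_{II}}\sup_{\sigma_I}\mathbb E[F(X_{\tau-1})]. $$ **Theorem.** For every $x_0$, $\sigma_I$, $\sigma_{II}$ the game stops almost surely, i.e. $\mathbb P(\tau<\infty)=1$, and $F(X_{\tau-1})$ is integrable. There is exactly one bounded Borel solution $u_\epsilon:\mathbb R^N\to\mathbb R$ of the DPP; it is continuous, and $$ u_I^\epsilon(x)=u_\epsilon(x)=u_{II}^\epsilon(x)\qquad\text{for all }x\in\mathbb R^N. $$ In particular, the game has a value. -/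

import Mathlib

open MeasureTheory Set Metric
open scoped ENNReal

namespace TugOfWar

noncomputable section

/-- The Euclidean space `ℝ^N`. -/
abbrev Space (N : ℕ) : Type := EuclideanSpace ℝ (Fin N)

/-- The open unit ball `B(0,1)` of `ℝ^N`, as a type. -/
abbrev UnitBall (N : ℕ) : Type := ball (0 : Space N) 1

/-! ### The dynamic programming principle -/

/-- The ellipse `E(x, ρ; α, ν)` with centre `x`, radius `ρ` and aspect ratio `α` along `ν`. For
`ν = 0` it is the ball `B(x, ρ)`. -/
def ellipse {N : ℕ} (x : Space N) (ρ α : ℝ) (ν : Space N) : Set (Space N) :=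
  {w | (inner ℝ (w - x) ν) ^ 2 / α ^ 2 + ‖(w - x) - (inner ℝ (w - x) ν) • ν‖ ^ 2 < ρ ^ 2}

/-- The average of `u` over the ellipse `E(x, ρ; α, ν)`. -/
def ellipseAverage {N : ℕ} (u : Space N → ℝ) (ρ α : ℝ) (ν : Space N) (x : Space N) : ℝ :=
  ⨍ w in ellipse x ρ α ν, u w

/-- The average `f_u(x; x₀, r)` of `u` over the ellipse centred at `x`, with radius `γ r` and aspect
ratio `1 + (a - 1) |x - x₀|² / r²` along `(x - x₀) / |x - x₀|` (which is `0` for `x = x₀`). -/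
def sampleAverage {N : ℕ} (γ a : ℝ) (u : Space N → ℝ) (x x₀ : Space N) (r : ℝ) : ℝ :=
  ellipseAverage u (γ * r) (1 + (a - 1) * (‖x - x₀‖ ^ 2 / r ^ 2)) (‖x - x₀‖⁻¹ • (x - x₀)) x

/-- The operator `S_r u (x₀) = ½ (inf + sup)_{x ∈ B(x₀, r)} f_u(x; x₀, r)`. -/
def averageOp {N : ℕ} (γ a r : ℝ) (u : Space N → ℝ) (x₀ : Space N) : ℝ :=
  (1 / 2) * ((⨅ x : ball x₀ r, sampleAverage γ a u x x₀ r) +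
    ⨆ x : ball x₀ r, sampleAverage γ a u x x₀ r)

/-- The scaled distance `d_ε(x) = ε⁻¹ min {ε, dist(x, ℝ^N \ D)}`. -/
def scaledDist {N : ℕ} (D : Set (Space N)) (ε : ℝ) (x : Space N) : ℝ :=
  (1 / ε) * min ε (infDist x Dᶜ)

/-- `u` is a bounded Borel solution of the dynamic programming principle
`u = d_ε S_ε u + (1 - d_ε) F` on `ℝ^N`. -/
structure IsDPPSolution {N : ℕ} (γ a : ℝ) (D : Set (Space N)) (F : Space N → ℝ) (ε : ℝ)
    (u : Space N → ℝ) : Prop where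
  measurable : Measurable u
  bounded : ∃ C : ℝ, ∀ x, |u x| ≤ C
  dpp : ∀ x, u x = scaledDist D ε x * averageOp γ a ε u x + (1 - scaledDist D ε x) * F x

/-! ### The probability space -/

/-- The outcome `(w, s, t) ∈ B(0,1) × {1,2} × (0,1)` of one turn; `s = true` means that player I
moves, `s = false` that player II moves. -/
abbrev Outcome (N : ℕ) : Type := UnitBall N × Bool × Ioo (0 : ℝ) 1

/-- The normalised Lebesgue measure on `B(0,1)`. -/
def ballLaw (N : ℕ) : Measure (UnitBall N) :=
  (volume (ball (0 : Space N) 1))⁻¹ • Measure.comap Subtype.val volume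

/-- The fair coin. -/
def coinLaw : Measure Bool := (2 : ℝ≥0∞)⁻¹ • Measure.count

/-- The Lebesgue measure on `(0,1)`. -/
def thresholdLaw : Measure (Ioo (0 : ℝ) 1) := Measure.comap Subtype.val volume

/-- The law of one turn. -/
def outcomeLaw (N : ℕ) : Measure (Outcome N) := (ballLaw N).prod (coinLaw.prod thresholdLaw)

instance (N : ℕ) : IsProbabilityMeasure (ballLaw N) where
  measure_univ := by
    rw [ballLaw, Measure.smul_apply, comap_subtype_coe_apply measurableSet_ball, Set.image_univ,
      Subtype.range_coe, smul_eq_mul]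
    exact ENNReal.inv_mul_cancel (measure_ball_pos volume _ one_pos).ne' measure_ball_lt_top.ne

instance : IsProbabilityMeasure coinLaw where
  measure_univ := by
    rw [coinLaw, Measure.smul_apply, Measure.count_univ, smul_eq_mul]
    simpa using ENNReal.inv_mul_cancel (a := 2) two_ne_zero ENNReal.ofNat_ne_top

instance : IsProbabilityMeasure thresholdLaw where
  measure_univ := by
    rw [thresholdLaw, comap_subtype_coe_apply measurableSet_Ioo, Set.image_univ,
      Subtype.range_coe]
    simp

instance (N : ℕ) : IsProbabilityMeasure (outcomeLaw N) := by
  unfold outcomeLaw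
  infer_instance

/-- The sample space; `ω n` is the outcome `(w_{n+1}, s_{n+1}, t_{n+1})` of turn `n + 1`. -/
abbrev Omega (N : ℕ) : Type := ℕ → Outcome N

/-- The law of the sequence of independent outcomes: the countable product of `outcomeLaw N`. -/
def gameLaw (N : ℕ) : Measure (Omega N) := Measure.infinitePi fun _ : ℕ => outcomeLaw N

/-! ### Strategies and the game -/

/-- Finite histories `(x₀, (x₁, w₁, s₁, t₁), …, (x_n, w_n, s_n, t_n))`, with the product
`σ`-algebra. -/
abbrev History (N n : ℕ) : Type := Space N × (Fin n → Space N × Outcome N)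

/-- The current position `x_n` of a history. -/
def History.position {N : ℕ} : {n : ℕ} → History N n → Space N
  | 0, h => h.1
  | n + 1, h => (h.2 (Fin.last n)).1

/-- A strategy: a sequence of Borel functions from the histories to `B(0,1)`. -/
structure Strategy (N : ℕ) where
  toFun : (n : ℕ) → History N n → UnitBall N
  measurable_toFun : ∀ n, Measurable (toFun n)

/-- The shift `y + γ w + γ (a - 1) ⟨w, y⟩ y` (before scaling by `ε`) that results from the choice
`y` of the active player and the noise `w`. -/
def shift {N : ℕ} (γ a : ℝ) (y w : Space N) : Space N :=
  y + γ • w + (γ * (a - 1) * inner ℝ w y) • y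

/-- The position after the history `h` is followed by the outcome `o`. -/
def nextPosition {N n : ℕ} (γ a ε : ℝ) (σI σII : Strategy N) (h : History N n) (o : Outcome N) :
    Space N :=
  h.position + ε • shift γ a (bif o.2.1 then σI.toFun n h else σII.toFun n h : UnitBall N) o.1

/-- The history after `n` turns of the game that starts at `x₀`. -/
def gameHistory {N : ℕ} (γ a ε : ℝ) (x₀ : Space N) (σI σII : Strategy N) (ω : Omega N) :
    (n : ℕ) → History N n
  | 0 => (x₀, Fin.elim0)
  | n + 1 =>
    let h := gameHistory γ a ε x₀ σI σII ω n
    (x₀, Fin.snoc (α := fun _ => Space N × Outcome N) h.2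
      (nextPosition γ a ε σI σII h (ω n), ω n))

/-- The position `X_n` of the token. -/
def process {N : ℕ} (γ a ε : ℝ) (x₀ : Space N) (σI σII : Strategy N) (n : ℕ) (ω : Omega N) :
    Space N :=
  (gameHistory γ a ε x₀ σI σII ω n).position

/-- The stopping time `τ = min {n ≥ 1 : t_n > d_ε(X_{n-1})}`, equal to `⊤` if there is no such
`n`. Here `n` is written `m + 1`, and `t_{m+1} = (ω m).2.2`. -/
def stoppingTime {N : ℕ} (γ a : ℝ) (D : Set (Space N)) (ε : ℝ) (x₀ : Space N)
    (σI σII : Strategy N) (ω : Omega N) : ℕ∞ :=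
  ⨅ (m : ℕ) (_ : scaledDist D ε (process γ a ε x₀ σI σII m ω) < ((ω m).2.2 : ℝ)),
    ((m + 1 : ℕ) : ℕ∞)

/-- The payoff `F(X_{τ-1})`. On the event `τ = ∞`, where the payoff has no meaning, the value is
`F(x₀)`. -/
def payoff {N : ℕ} (γ a : ℝ) (D : Set (Space N)) (F : Space N → ℝ) (ε : ℝ) (x₀ : Space N)
    (σI σII : Strategy N) (ω : Omega N) : ℝ :=
  F (process γ a ε x₀ σI σII ((stoppingTime γ a D ε x₀ σI σII ω).toNat - 1) ω)

/-- The expected payoff `E[F(X_{τ-1})]`. -/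
def expectedPayoff {N : ℕ} (γ a : ℝ) (D : Set (Space N)) (F : Space N → ℝ) (ε : ℝ) (x₀ : Space N)
    (σI σII : Strategy N) : ℝ :=
  ∫ ω, payoff γ a D F ε x₀ σI σII ω ∂(gameLaw N)

/-- The value `sup_{σ_I} inf_{σ_II} E[F(X_{τ-1})]` for player I; supremum and infimum are taken in
the extended reals. -/
def valueI {N : ℕ} (γ a : ℝ) (D : Set (Space N)) (F : Space N → ℝ) (ε : ℝ) (x₀ : Space N) :
    EReal :=
  ⨆ σI : Strategy N, ⨅ σII : Strategy N, (expectedPayoff γ a D F ε x₀ σI σII : EReal)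

/-- The value `inf_{σ_II} sup_{σ_I} E[F(X_{τ-1})]` for player II; supremum and infimum are taken in
the extended reals. -/
def valueII {N : ℕ} (γ a : ℝ) (D : Set (Space N)) (F : Space N → ℝ) (ε : ℝ) (x₀ : Space N) :
    EReal :=
  ⨅ σII : Strategy N, ⨆ σI : Strategy N, (expectedPayoff γ a D F ε x₀ σI σII : EReal)

end

end TugOfWar

namespace TugOfWar

/-! ### Averages over ellipses as averages over the noise -/

/-! Each sampling ellipse is an affine image of the unit ball, so the average over it is
`noiseAverage`, the expectation of `u` after one move with choice `y`
(`sampleAverage_eq_noiseAverage`). Thus `averageOp` is half the sum of the infimum and the supremum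
over `y` of one-move expectations.

Everything then rests on one function, a weight `φ` with `1 ≤ φ ≤ M` whose one-move expectation from
a point of `D` is at most `κ φ` with `κ < 1`, whatever is chosen (`exists_isDecreasingWeight`). It
exists because, under the scaling condition, noise close to a fixed unit vector `e` pushes the token
forward along `e` against every choice.

The weight is used three times. The right-hand side of the DPP contracts the norm `sup |u| / φ`,
which gives a continuous solution by Banach's theorem and uniqueness among bounded Borel ones
(`abs_dppOp_sub_le`). The probability of still playing after `n` turns is at most `κ ^ n * φ x₀`
(`measureReal_inPlay_le`). Finally, `u - η φ` satisfies the one-turn inequality with room to spare,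
so a player may miss the optimal choice by the same fixed error on every turn and use a stationary
strategy (`IsDPPSolution.sub_le_turnValue`).

With such a strategy `u - η φ` along the game, completed by the payoff after stopping, has
nondecreasing expectation, whence `u x - η M ≤ E` (`le_expectedPayoff`). Conditional expectations
are replaced by resampling a single coordinate of the product space. Player II is player I for `-u`
and `-F`. -/

theorem integral_ballLaw {N : ℕ} (f : Space N → ℝ) :
    ∫ w : UnitBall N, f w ∂ballLaw N =
      (volume.real (ball (0 : Space N) 1))⁻¹ * ∫ w in ball (0 : Space N) 1, f w := by
  rw [ballLaw, integral_smul_measure, integral_subtype_comap measurableSet_ball f, smul_eq_mul,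
    ENNReal.toReal_inv]
  rfl

/-- The linear map that multiplies by `ρ α` along `ν` and by `ρ` orthogonally to `ν`. -/
noncomputable def stretch {N : ℕ} (ρ α : ℝ) (ν : Space N) : Space N →L[ℝ] Space N :=
  ρ • (ContinuousLinearMap.id ℝ (Space N) + (α - 1) • (innerSL ℝ ν).smulRight ν)

theorem stretch_apply {N : ℕ} (ρ α : ℝ) (ν w : Space N) :
    stretch ρ α ν w = ρ • (w + ((α - 1) * inner ℝ w ν) • ν) := by
  simp [stretch, smul_smul, real_inner_comm, mul_assoc]

theorem inner_stretch {N : ℕ} (ρ α : ℝ) {ν : Space N} (hν : ‖ν‖ = 1 ∨ ν = 0) (w : Space N) :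
    inner ℝ (stretch ρ α ν w) ν = ρ * α * inner ℝ w ν := by
  rw [stretch_apply, inner_smul_left, inner_add_left, inner_smul_left, real_inner_self_eq_norm_sq]
  rcases hν with hν | hν
  · rw [hν]; simp; ring
  · simp [hν]

/-- The part along `ν` is scaled by `ρ α` and then divided by `α`, so Pythagoras applies. This makes
the ellipse the image of the ball, and it also gives injectivity. -/
theorem stretch_quadratic {N : ℕ} (ρ : ℝ) {α : ℝ} (hα : 0 < α) {ν : Space N}
    (hν : ‖ν‖ = 1 ∨ ν = 0) (w : Space N) :
    (inner ℝ (stretch ρ α ν w) ν) ^ 2 / α ^ 2 +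
      ‖stretch ρ α ν w - (inner ℝ (stretch ρ α ν w) ν) • ν‖ ^ 2 = ρ ^ 2 * ‖w‖ ^ 2 := by
  have h1 : stretch ρ α ν w - (inner ℝ (stretch ρ α ν w) ν) • ν
      = ρ • (w - inner ℝ w ν • ν) := by
    rw [inner_stretch ρ α hν, stretch_apply]; module
  have h2 : ‖w - inner ℝ w ν • ν‖ ^ 2 = ‖w‖ ^ 2 - inner ℝ w ν ^ 2 := by
    rw [norm_sub_sq_real, inner_smul_right, norm_smul, mul_pow, Real.norm_eq_abs, sq_abs]
    rcases hν with hν | hν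
    · rw [hν]; ring
    · simp [hν]
  rw [h1, norm_smul, mul_pow, h2, inner_stretch ρ α hν, Real.norm_eq_abs, sq_abs]
  field_simp
  ring

theorem stretch_injective {N : ℕ} {ρ α : ℝ} (hρ : 0 < ρ) (hα : 0 < α) {ν : Space N}
    (hν : ‖ν‖ = 1 ∨ ν = 0) : Function.Injective (stretch ρ α ν) := by
  rw [injective_iff_map_eq_zero]
  intro w hw
  have h := stretch_quadratic ρ hα hν w
  rw [hw] at h
  simpa [hρ.ne'] using h.symm

theorem ellipse_eq_image {N : ℕ} (x : Space N) {ρ α : ℝ} (hρ : 0 < ρ) (hα : 0 < α)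
    {ν : Space N} (hν : ‖ν‖ = 1 ∨ ν = 0) :
    ellipse x ρ α ν = (fun w => x + stretch ρ α ν w) '' ball 0 1 := by
  have hsurj : Function.Surjective (stretch ρ α ν) :=
    (LinearMap.injective_iff_surjective (f := (stretch ρ α ν).toLinearMap)).1
      (stretch_injective hρ hα hν)
  have key : ∀ w, x + stretch ρ α ν w ∈ ellipse x ρ α ν ↔ w ∈ ball (0 : Space N) 1 := by
    intro w
    rw [ellipse, mem_ofPred_eq, add_sub_cancel_left, stretch_quadratic ρ hα hν, mem_ball_zero_iff]
    have hρ2 : 0 < ρ ^ 2 := by positivity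
    rw [mul_lt_iff_lt_one_right hρ2, sq_lt_one_iff₀ (norm_nonneg w)]
  ext z
  constructor
  · intro hz
    obtain ⟨w, hw⟩ := hsurj (z - x)
    have hz' : x + stretch ρ α ν w = z := by rw [hw]; abel
    exact ⟨w, (key w).1 (hz' ▸ hz), hz'⟩
  · rintro ⟨w, hw, rfl⟩
    exact (key w).2 hw

theorem ellipseAverage_eq_integral {N : ℕ} (u : Space N → ℝ) {ρ α : ℝ} (hρ : 0 < ρ) (hα : 0 < α)
    {ν : Space N} (hν : ‖ν‖ = 1 ∨ ν = 0) (x : Space N) :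
    ellipseAverage u ρ α ν x = ∫ w : UnitBall N, u (x + stretch ρ α ν w) ∂ballLaw N := by
  have hinj := stretch_injective hρ hα hν
  -- The Jacobian is constant and cancels between integral and volume, so it need only be nonzero.
  have hdet : (stretch ρ α ν).det ≠ 0 := by
    intro h
    have := LinearMap.bot_lt_ker_of_det_eq_zero h
    rw [LinearMap.ker_eq_bot.2 hinj] at this
    exact lt_irrefl _ this
  have hcov : ∀ g : Space N → ℝ, ∫ z in ellipse x ρ α ν, g z =
      |(stretch ρ α ν).det| * ∫ w in ball (0 : Space N) 1, g (x + stretch ρ α ν w) := by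
    intro g
    rw [ellipse_eq_image x hρ hα hν, integral_image_eq_integral_abs_det_fderiv_smul volume
      (f' := fun _ => stretch ρ α ν) measurableSet_ball
      (fun w _ => ((stretch ρ α ν).hasFDerivAt.const_add x).hasFDerivWithinAt)
      (fun w _ w' _ h => hinj (add_left_cancel h))]
    simp only [smul_eq_mul]
    rw [integral_const_mul]
  have hvol : volume.real (ellipse x ρ α ν) =
      |(stretch ρ α ν).det| * volume.real (ball (0 : Space N) 1) := by
    have h := hcov fun _ => 1
    simpa using h
  rw [ellipseAverage, setAverage_eq, hcov, hvol, smul_eq_mul,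
    integral_ballLaw fun w => u (x + stretch ρ α ν w), mul_inv]
  field_simp

/-- The average of `u` over the position that follows `x` when the active player chooses `y`. -/
noncomputable def noiseAverage {N : ℕ} (γ a ε : ℝ) (u : Space N → ℝ) (y x : Space N) : ℝ :=
  ∫ w : UnitBall N, u (x + ε • shift γ a y w) ∂ballLaw N

/-- At `x + ε y` the aspect ratio is `1 + (a - 1) |y|²` and the axis is `y / |y|`. The factor `|y|²`
cancels the two normalisations, which leaves the term `(a - 1) ⟨w, y⟩ y` of `shift`. -/
theorem sampleAverage_eq_noiseAverage {N : ℕ} {γ a ε : ℝ} (hγ : 0 < γ) (ha : 0 < a) (hε : 0 < ε)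
    (u : Space N → ℝ) {y : Space N} (hy : ‖y‖ < 1) (x : Space N) :
    sampleAverage γ a u (x + ε • y) x ε = noiseAverage γ a ε u y x := by
  have hsq : ‖y‖ ^ 2 < 1 := (sq_lt_one_iff₀ (norm_nonneg y)).2 hy
  have hα : 0 < 1 + (a - 1) * (‖ε • y‖ ^ 2 / ε ^ 2) := by
    rw [norm_smul, mul_pow, Real.norm_eq_abs, sq_abs, mul_div_cancel_left₀ _ (by positivity)]
    -- The aspect ratio is `(1 - |y|²) + a |y|²`.
    nlinarith [sq_nonneg ‖y‖, mul_nonneg ha.le (sq_nonneg ‖y‖)]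
  have hν : ‖‖ε • y‖⁻¹ • ε • y‖ = 1 ∨ ‖ε • y‖⁻¹ • ε • y = 0 := by
    rcases eq_or_ne y 0 with rfl | h
    · right; simp
    · left
      exact norm_smul_inv_norm (𝕜 := ℝ) (smul_ne_zero hε.ne' h)
  rw [sampleAverage, add_sub_cancel_left, ellipseAverage_eq_integral u (by positivity) hα hν,
    noiseAverage]
  refine integral_congr_ae (.of_forall fun w => ?_)
  simp only
  congr 1
  rw [add_assoc, add_right_inj, stretch_apply, shift]
  have hdir : ‖ε • y‖⁻¹ • ε • y = ‖y‖⁻¹ • y := by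
    rw [norm_smul, Real.norm_of_nonneg hε.le, smul_smul, mul_inv]
    congr 1
    field_simp
  rw [hdir, norm_smul, Real.norm_of_nonneg hε.le]
  rcases eq_or_ne y 0 with rfl | h
  · simp [smul_smul, mul_comm]
  · have hn : ‖y‖ ≠ 0 := norm_ne_zero_iff.2 h
    rw [inner_smul_right]
    have : (1 + (a - 1) * ((ε * ‖y‖) ^ 2 / ε ^ 2) - 1) * (‖y‖⁻¹ * inner ℝ (w : Space N) y) * ‖y‖⁻¹
        = (a - 1) * inner ℝ (w : Space N) y := by
      field_simp
      ring
    rw [smul_smul _ (‖y‖⁻¹), this]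
    module

theorem averageOp_eq {N : ℕ} {γ a ε : ℝ} (hγ : 0 < γ) (ha : 0 < a) (hε : 0 < ε)
    (u : Space N → ℝ) (x : Space N) :
    averageOp γ a ε u x = (1 / 2) * ((⨅ y : UnitBall N, noiseAverage γ a ε u y x) +
      ⨆ y : UnitBall N, noiseAverage γ a ε u y x) := by
  let e : UnitBall N → ball x ε := fun y => ⟨x + ε • (y : Space N), by
    have hy := y.2
    rw [mem_ball_zero_iff] at hy
    rw [mem_ball_iff_norm, add_sub_cancel_left, norm_smul, Real.norm_of_nonneg hε.le]
    nlinarith⟩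
  have he : Function.Surjective e := by
    intro z
    have hz := z.2
    rw [mem_ball_iff_norm] at hz
    refine ⟨⟨ε⁻¹ • (z - x), ?_⟩, ?_⟩
    · rw [mem_ball_zero_iff, norm_smul, norm_inv, Real.norm_of_nonneg hε.le,
        inv_mul_lt_iff₀ hε, mul_one]
      exact hz
    · apply Subtype.ext
      simp [e, smul_smul, hε.ne']
  have hs : ∀ y : UnitBall N, sampleAverage γ a u (e y) x ε = noiseAverage γ a ε u y x :=
    fun y => sampleAverage_eq_noiseAverage hγ ha hε u (mem_ball_zero_iff.1 y.2) x
  rw [averageOp, ← he.iInf_comp, ← he.iSup_comp]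
  simp only [hs]

/-! ### Elementary properties of the noise average -/

theorem continuous_shift {N : ℕ} (γ a : ℝ) :
    Continuous fun q : Space N × Space N => shift γ a q.1 q.2 := by
  unfold shift
  fun_prop

theorem integrable_noise {N : ℕ} (γ a ε : ℝ) {u : Space N → ℝ} (hu : Measurable u) {C : ℝ}
    (hC : ∀ x, |u x| ≤ C) (y x : Space N) :
    Integrable (fun w : UnitBall N => u (x + ε • shift γ a y w)) (ballLaw N) := by
  have hm : Measurable fun w : UnitBall N => x + ε • shift γ a y w := by
    have : Continuous fun w : UnitBall N => x + ε • shift γ a y w := by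
      unfold shift
      fun_prop
    exact this.measurable
  exact .of_bound (hu.comp hm).aestronglyMeasurable C (.of_forall fun w => hC _)

theorem abs_noiseAverage_le {N : ℕ} (γ a ε : ℝ) {u : Space N → ℝ} {C : ℝ}
    (hC : ∀ x, |u x| ≤ C) (y x : Space N) : |noiseAverage γ a ε u y x| ≤ C := by
  have h := norm_integral_le_of_norm_le_const (μ := ballLaw N) (C := C)
    (f := fun w : UnitBall N => u (x + ε • shift γ a y w)) (.of_forall fun w => hC _)
  simpa [noiseAverage] using h

theorem noiseAverage_neg {N : ℕ} (γ a ε : ℝ) (u : Space N → ℝ) (y x : Space N) :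
    noiseAverage γ a ε (fun z => -u z) y x = -noiseAverage γ a ε u y x :=
  integral_neg _

theorem noiseAverage_add_mul {N : ℕ} (γ a ε : ℝ) {u φ : Space N → ℝ} (hu : Measurable u)
    (hφ : Measurable φ) {C M : ℝ} (hC : ∀ x, |u x| ≤ C) (hM : ∀ x, |φ x| ≤ M) (K : ℝ)
    (y x : Space N) :
    noiseAverage γ a ε (fun z => u z + K * φ z) y x =
      noiseAverage γ a ε u y x + K * noiseAverage γ a ε φ y x := by
  rw [noiseAverage, integral_add (integrable_noise γ a ε hu hC y x)
    ((integrable_noise γ a ε hφ hM y x).const_mul K), integral_const_mul]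
  rfl

theorem noiseAverage_mono {N : ℕ} (γ a ε : ℝ) {u v : Space N → ℝ} (hu : Measurable u)
    (hv : Measurable v) {C C' : ℝ} (hC : ∀ x, |u x| ≤ C) (hC' : ∀ x, |v x| ≤ C')
    (huv : ∀ x, u x ≤ v x) (y x : Space N) :
    noiseAverage γ a ε u y x ≤ noiseAverage γ a ε v y x :=
  integral_mono (integrable_noise γ a ε hu hC y x) (integrable_noise γ a ε hv hC' y x)
    fun _ => huv _

theorem bddAbove_noiseAverage {N : ℕ} (γ a ε : ℝ) {u : Space N → ℝ} {C : ℝ}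
    (hC : ∀ x, |u x| ≤ C) (x : Space N) :
    BddAbove (range fun y : UnitBall N => noiseAverage γ a ε u y x) :=
  ⟨C, by rintro _ ⟨y, rfl⟩; exact (abs_le.1 (abs_noiseAverage_le γ a ε hC y x)).2⟩

theorem bddBelow_noiseAverage {N : ℕ} (γ a ε : ℝ) {u : Space N → ℝ} {C : ℝ}
    (hC : ∀ x, |u x| ≤ C) (x : Space N) :
    BddBelow (range fun y : UnitBall N => noiseAverage γ a ε u y x) :=
  ⟨-C, by rintro _ ⟨y, rfl⟩; exact (abs_le.1 (abs_noiseAverage_le γ a ε hC y x)).1⟩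

instance (N : ℕ) : Nonempty (UnitBall N) := ⟨⟨0, mem_ball_self one_pos⟩⟩

theorem continuous_noiseAverage {N : ℕ} (γ a ε : ℝ) {u : Space N → ℝ} (hu : Continuous u) {C : ℝ}
    (hC : ∀ x, |u x| ≤ C) :
    Continuous fun q : Space N × Space N => noiseAverage γ a ε u q.1 q.2 := by
  refine continuous_of_dominated (bound := fun _ => C)
    (fun q => (integrable_noise γ a ε hu.measurable hC q.1 q.2).aestronglyMeasurable)
    (fun q => .of_forall fun w => hC _) (integrable_const C) (.of_forall fun w => ?_)
  unfold shift
  fun_prop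

/-- By continuity in `y` the supremum over the open ball equals that over the closed ball, and a
supremum over a compact set of a jointly continuous function is continuous in the parameter. -/
theorem continuous_iSup_noiseAverage {N : ℕ} (γ a ε : ℝ) {u : Space N → ℝ} (hu : Continuous u)
    {C : ℝ} (hC : ∀ x, |u x| ≤ C) :
    Continuous fun x => ⨆ y : UnitBall N, noiseAverage γ a ε u y x := by
  have hc := continuous_noiseAverage γ a ε hu hC
  have hs : Continuous fun x : Space N =>
      sSup ((fun y => noiseAverage γ a ε u y x) '' closedBall (0 : Space N) 1) :=
    (isCompact_closedBall (0 : Space N) 1).continuous_sSup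
      (f := fun x y => noiseAverage γ a ε u y x) (hc.comp continuous_swap)
  convert hs using 2 with x
  have hbdd : BddAbove ((fun y => noiseAverage γ a ε u y x) '' closedBall (0 : Space N) 1) :=
    ⟨C, by rintro _ ⟨y, -, rfl⟩; exact (abs_le.1 (abs_noiseAverage_le γ a ε hC y x)).2⟩
  apply le_antisymm
  · exact ciSup_le fun y => le_csSup hbdd ⟨y, ball_subset_closedBall y.2, rfl⟩
  · refine csSup_le ((nonempty_closedBall.2 zero_le_one).image _) ?_
    rintro _ ⟨y, hy, rfl⟩
    rw [← closure_ball (0 : Space N) one_ne_zero] at hy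
    have hcx : Continuous fun y => noiseAverage γ a ε u y x :=
      hc.comp (continuous_id.prodMk continuous_const)
    exact closure_minimal (s := ball (0 : Space N) 1)
      (t := {y | noiseAverage γ a ε u y x ≤ ⨆ y : UnitBall N, noiseAverage γ a ε u y x})
      (fun z hz => le_ciSup (bddAbove_noiseAverage γ a ε hC x) ⟨z, hz⟩)
      (isClosed_le hcx continuous_const) hy

theorem iInf_noiseAverage_eq {N : ℕ} (γ a ε : ℝ) (u : Space N → ℝ) (x : Space N) :
    ⨅ y : UnitBall N, noiseAverage γ a ε u y x =
      -⨆ y : UnitBall N, noiseAverage γ a ε (fun z => -u z) y x := by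
  simp only [noiseAverage_neg, iSup, iInf]
  rw [Real.sInf_def]
  congr 2
  ext t
  simp [neg_eq_iff_eq_neg, eq_comm]

theorem continuous_averageOp {N : ℕ} {γ a ε : ℝ} (hγ : 0 < γ) (ha : 0 < a) (hε : 0 < ε)
    {u : Space N → ℝ} (hu : Continuous u) {C : ℝ} (hC : ∀ x, |u x| ≤ C) :
    Continuous (averageOp γ a ε u) := by
  have : averageOp γ a ε u = fun x => (1 / 2) *
      ((-⨆ y : UnitBall N, noiseAverage γ a ε (fun z => -u z) y x) +
        ⨆ y : UnitBall N, noiseAverage γ a ε u y x) := by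
    funext x
    rw [averageOp_eq hγ ha hε, iInf_noiseAverage_eq]
  rw [this]
  exact continuous_const.mul ((continuous_iSup_noiseAverage γ a ε hu.neg (C := C)
    (fun x => by simpa using hC x)).neg.add (continuous_iSup_noiseAverage γ a ε hu hC))

theorem abs_averageOp_le {N : ℕ} {γ a ε : ℝ} (hγ : 0 < γ) (ha : 0 < a) (hε : 0 < ε)
    {u : Space N → ℝ} {C : ℝ} (hC : ∀ x, |u x| ≤ C) (x : Space N) :
    |averageOp γ a ε u x| ≤ C := by
  have h := fun y : UnitBall N => abs_le.1 (abs_noiseAverage_le γ a ε hC y x)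
  have h1 : ⨆ y : UnitBall N, noiseAverage γ a ε u y x ≤ C := ciSup_le fun y => (h y).2
  have h2 : -C ≤ ⨅ y : UnitBall N, noiseAverage γ a ε u y x := le_ciInf fun y => (h y).1
  let y₀ : UnitBall N := Classical.arbitrary _
  have h3 := le_ciSup (bddAbove_noiseAverage γ a ε hC x) y₀
  have h4 := ciInf_le (bddBelow_noiseAverage γ a ε hC x) y₀
  have h5 := h y₀
  rw [averageOp_eq hγ ha hε, abs_le]
  constructor <;> linarith

/-! ### The scaled distance -/

theorem scaledDist_nonneg {N : ℕ} (D : Set (Space N)) {ε : ℝ} (hε : 0 < ε) (x : Space N) :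
    0 ≤ scaledDist D ε x :=
  mul_nonneg (by positivity) (le_min hε.le infDist_nonneg)

theorem scaledDist_le_one {N : ℕ} (D : Set (Space N)) {ε : ℝ} (hε : 0 < ε) (x : Space N) :
    scaledDist D ε x ≤ 1 := by
  rw [scaledDist, one_div, inv_mul_le_iff₀ hε, mul_one]
  exact min_le_left _ _

theorem scaledDist_eq_zero {N : ℕ} {D : Set (Space N)} {ε : ℝ} (hε : 0 < ε) {x : Space N}
    (hx : x ∉ D) : scaledDist D ε x = 0 := by
  rw [scaledDist, infDist_zero_of_mem (show x ∈ Dᶜ from hx), min_eq_right hε.le, mul_zero]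

theorem continuous_scaledDist {N : ℕ} (D : Set (Space N)) (ε : ℝ) :
    Continuous (scaledDist D ε) :=
  continuous_const.mul (continuous_const.min (continuous_infDist_pt _))

/-! ### A weight that decreases on average -/

/-- `φ` is a bounded continuous weight whose average after one turn from a point of `D` is at most
`κ φ`, whatever the active player does. -/
structure IsDecreasingWeight {N : ℕ} (γ a ε : ℝ) (D : Set (Space N)) (κ M : ℝ)
    (φ : Space N → ℝ) : Prop where
  continuous : Continuous φ
  one_le : ∀ x, 1 ≤ φ x
  le_bound : ∀ x, φ x ≤ M
  rate_nonneg : 0 ≤ κ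
  rate_lt_one : κ < 1
  noiseAverage_le : ∀ x ∈ D, ∀ y : UnitBall N, noiseAverage γ a ε φ y x ≤ κ * φ x

theorem IsDecreasingWeight.abs_le {N : ℕ} {γ a ε : ℝ} {D : Set (Space N)} {κ M : ℝ}
    {φ : Space N → ℝ} (hφ : IsDecreasingWeight γ a ε D κ M φ) (x : Space N) : |φ x| ≤ M := by
  rw [abs_of_nonneg (zero_le_one.trans (hφ.one_le x))]
  exact hφ.le_bound x

/-- The scaling condition makes the noise in the direction `e` outweigh every choice of the active
player. -/
theorem exists_drift {N : ℕ} {γ a : ℝ} (hγ : 0 < γ)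
    (h : (a ≤ 1 ∧ 1 < γ * a) ∨ (1 ≤ a ∧ 1 < γ)) {e : Space N} (he : ‖e‖ = 1) :
    ∃ c > 0, ∃ r > 0, ∀ y w : Space N, ‖y‖ < 1 → ‖w - e‖ < r →
      c ≤ inner ℝ (shift γ a y w) e := by
  -- With `s = ⟨y, e⟩`, the expression is the drift for `w = e`. Its lower bound is `γ a - 1` or `γ
  -- - 1`, according to the sign of `a - 1`.
  obtain ⟨c, hc, hce⟩ : ∃ c > 0, ∀ s : ℝ, |s| < 1 → c ≤ s + γ + γ * (a - 1) * s ^ 2 := by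
    rcases h with ⟨h1, h2⟩ | ⟨h1, h2⟩
    · refine ⟨γ * a - 1, by linarith, fun s hs => ?_⟩
      rw [abs_lt] at hs
      have : s ^ 2 ≤ 1 := by nlinarith
      nlinarith [mul_nonneg (mul_nonneg hγ.le (sub_nonneg.2 h1)) (sub_nonneg.2 this)]
    · refine ⟨γ - 1, by linarith, fun s hs => ?_⟩
      rw [abs_lt] at hs
      nlinarith [mul_nonneg (mul_nonneg hγ.le (sub_nonneg.2 h1)) (sq_nonneg s)]
  have hk : 0 < γ + γ * |a - 1| := by positivity
  -- Replacing `e` by `w` changes the drift by at most `γ (1 + |a - 1|) |w - e|`; half of `c` pays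
  -- for it.
  refine ⟨c / 2, by positivity, c / 2 / (γ + γ * |a - 1|), by positivity, fun y w hy hw => ?_⟩
  have hye : |inner ℝ y e| < 1 := by
    refine (abs_real_inner_le_norm y e).trans_lt ?_
    rw [he, mul_one]; exact hy
  have h1 := hce _ hye
  have hwe : |inner ℝ (w - e) e| ≤ ‖w - e‖ := by
    simpa [he] using abs_real_inner_le_norm (w - e) e
  have hwy : |inner ℝ (w - e) y| ≤ ‖w - e‖ := by
    refine (abs_real_inner_le_norm (w - e) y).trans ?_
    nlinarith [norm_nonneg (w - e)]
  have hprod : |(a - 1) * (inner ℝ (w - e) y * inner ℝ y e)| ≤ |a - 1| * ‖w - e‖ := by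
    rw [abs_mul, abs_mul]
    refine mul_le_mul_of_nonneg_left ?_ (abs_nonneg _)
    nlinarith [abs_nonneg (inner ℝ (w - e) y), abs_nonneg (inner ℝ y e)]
  have hexp : inner ℝ (shift γ a y w) e = (inner ℝ y e + γ + γ * (a - 1) * (inner ℝ y e) ^ 2) +
      γ * (inner ℝ (w - e) e + (a - 1) * (inner ℝ (w - e) y * inner ℝ y e)) := by
    simp only [shift, inner_add_left, inner_smul_left, inner_sub_left, real_inner_self_eq_norm_sq,
      he, real_inner_comm e y, RCLike.conj_to_real]
    ring
  have hsmall : γ * (‖w - e‖ + |a - 1| * ‖w - e‖) ≤ c / 2 := by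
    rw [lt_div_iff₀ hk] at hw
    linarith
  have hlow := mul_le_mul_of_nonneg_left (add_le_add (neg_le_of_abs_le hwe)
    (neg_le_of_abs_le hprod)) hγ.le
  rw [hexp]
  linarith

/-- The vector `e` is not in the open ball but in its closure, so each neighbourhood of `e` meets
the ball in a nonempty open set. -/
theorem ballLaw_real_pos {N : ℕ} {e : Space N} (he : ‖e‖ = 1) {r : ℝ} (hr : 0 < r) :
    0 < (ballLaw N).real {w : UnitBall N | ‖(w : Space N) - e‖ < r} := by
  have hopen : IsOpen {w : Space N | ‖w - e‖ < r} :=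
    isOpen_lt (by fun_prop) continuous_const
  have hmeas : MeasurableSet {w : UnitBall N | ‖(w : Space N) - e‖ < r} :=
    measurable_subtype_coe hopen.measurableSet
  have hne : (ball (0 : Space N) 1 ∩ {w : Space N | ‖w - e‖ < r}).Nonempty := by
    have hcl : e ∈ closure (ball (0 : Space N) 1) := by
      rw [closure_ball _ one_ne_zero]
      simp [he]
    obtain ⟨w, hw1, hw2⟩ := mem_closure_iff.1 hcl _ hopen (by simpa using hr)
    exact ⟨w, hw2, hw1⟩
  rw [measureReal_def, ENNReal.toReal_pos_iff]
  refine ⟨?_, measure_lt_top _ _⟩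
  rw [ballLaw, Measure.smul_apply, comap_subtype_coe_apply measurableSet_ball, smul_eq_mul]
  have himg : Subtype.val '' {w : UnitBall N | ‖(w : Space N) - e‖ < r} =
      ball (0 : Space N) 1 ∩ {w : Space N | ‖w - e‖ < r} :=
    Subtype.image_preimage_coe (ball (0 : Space N) 1) {w : Space N | ‖w - e‖ < r}
  rw [himg]
  exact ENNReal.mul_pos (ENNReal.inv_ne_zero.2 measure_ball_lt_top.ne)
    ((isOpen_ball.inter hopen).measure_pos volume hne).ne'

/-- The function `exp (l ⟨x, e⟩)` at least doubles on average for large `l`: with probability at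
least `q` it gains the factor `exp (l ε c)`, and all other outcomes may be discounted to zero.
Truncating it gives a bounded `ψ` that still grows by `δ` on average from `D`, and `1 + B - ψ`
decreases. -/
theorem exists_isDecreasingWeight {N : ℕ} (hN : 1 ≤ N) {γ a ε : ℝ} (hγ : 0 < γ)
    (h : (a ≤ 1 ∧ 1 < γ * a) ∨ (1 ≤ a ∧ 1 < γ)) (hε : 0 < ε) {D : Set (Space N)}
    (hD : Bornology.IsBounded D) :
    ∃ κ M : ℝ, ∃ φ : Space N → ℝ, IsDecreasingWeight γ a ε D κ M φ := by
  obtain ⟨e, he⟩ : ∃ e : Space N, ‖e‖ = 1 :=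
    ⟨EuclideanSpace.single ⟨0, hN⟩ 1, by simp⟩
  obtain ⟨c, hc, r, hr, hdrift⟩ := exists_drift hγ h he
  obtain ⟨R, hR0, hR⟩ : ∃ R ≥ 0, ∀ x ∈ D, |inner ℝ x e| ≤ R := by
    obtain ⟨R, hR⟩ := hD.exists_norm_le
    refine ⟨max R 0, le_max_right _ _, fun x hx => ?_⟩
    refine (abs_real_inner_le_norm x e).trans ?_
    rw [he, mul_one]
    exact (hR x hx).trans (le_max_left _ _)
  set G : Set (UnitBall N) := {w | ‖(w : Space N) - e‖ < r} with hG
  have hGm : MeasurableSet G := by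
    have hopen : IsOpen G := isOpen_lt (by fun_prop) continuous_const
    exact hopen.measurableSet
  have hq : 0 < (ballLaw N).real G := ballLaw_real_pos he hr
  set q := (ballLaw N).real G
  -- Here `l ε c = 2 / q`, and `exp (2 / q) ≥ 2 / q`.
  obtain ⟨l, hl0, hl⟩ : ∃ l : ℝ, 0 < l ∧ 2 ≤ q * Real.exp (l * (ε * c)) := by
    refine ⟨2 / q / (ε * c), by positivity, ?_⟩
    rw [div_mul_cancel₀ _ (by positivity)]
    have h1 := Real.add_one_le_exp (2 / q)
    calc (2 : ℝ) = q * (2 / q) := by field_simp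
      _ ≤ q * Real.exp (2 / q) := by gcongr; linarith
  -- One drift step of length `ε c` from `D` stays below this level, so truncation does not destroy
  -- the gain that is counted. The constant `δ` below is a lower bound of the exponential on `D`.
  set B := Real.exp (l * (R + ε * c)) with hB
  have hB1 : 1 ≤ B := Real.one_le_exp (by positivity)
  set δ := Real.exp (-(l * R)) with hδ
  have hδ0 : 0 < δ := Real.exp_pos _
  have hδ1 : δ ≤ 1 := Real.exp_le_one_iff.2 (by nlinarith)
  set ψ : Space N → ℝ := fun x => min (Real.exp (l * inner ℝ x e)) B with hψ
  have hψ0 : ∀ x, 0 ≤ ψ x := fun x => le_min (Real.exp_pos _).le (by linarith)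
  have hψB : ∀ x, ψ x ≤ B := fun x => min_le_right _ _
  have hψabs : ∀ x, |ψ x| ≤ B := fun x => by rw [abs_of_nonneg (hψ0 x)]; exact hψB x
  have hψc : Continuous ψ := by
    have : Continuous fun x : Space N => inner ℝ x e := continuous_id.inner continuous_const
    exact (Real.continuous_exp.comp (continuous_const.mul this)).min continuous_const
  have hψD : ∀ x ∈ D, ∀ y : UnitBall N, ψ x + δ ≤ noiseAverage γ a ε ψ y x := by
    intro x hx y
    have hxR := abs_le.1 (hR x hx)
    have hψx : ψ x ≤ Real.exp (l * inner ℝ x e) := min_le_left _ _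
    have hlow : δ ≤ Real.exp (l * inner ℝ x e) := Real.exp_le_exp.2 (by nlinarith [hxR.1])
    have hGb : ∀ w : UnitBall N, G.indicator (fun _ => Real.exp (l * (inner ℝ x e + ε * c))) w ≤
        ψ (x + ε • shift γ a y w) := by
      intro w
      by_cases hw : w ∈ G
      · rw [indicator_of_mem hw]
        have hd := hdrift y w (mem_ball_zero_iff.1 y.2) hw
        refine le_min (Real.exp_le_exp.2 ?_) (Real.exp_le_exp.2 ?_)
        · rw [inner_add_left, inner_smul_left, RCLike.conj_to_real]
          gcongr
        · gcongr
          exact hxR.2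
      · rw [indicator_of_notMem hw]
        exact hψ0 _
    have hint := integral_mono ((integrable_const _).indicator hGm)
      (integrable_noise γ a ε hψc.measurable hψabs y x) hGb
    rw [integral_indicator_const _ hGm, smul_eq_mul] at hint
    have hsplit : Real.exp (l * (inner ℝ x e + ε * c)) =
        Real.exp (l * inner ℝ x e) * Real.exp (l * (ε * c)) := by
      rw [← Real.exp_add]; ring_nf
    rw [hsplit] at hint
    have := mul_le_mul_of_nonneg_left hl (Real.exp_pos (l * inner ℝ x e)).le
    refine le_trans ?_ hint
    change _ ≤ q * _
    linarith
  -- The fixed decrease `δ` becomes a factor because the weight is at most `1 + B`.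
  refine ⟨1 - δ / (1 + B), 1 + B, fun x => (1 + B) + (-1) * ψ x, ?_, ?_, ?_, ?_, ?_, ?_⟩
  · fun_prop
  · intro x; linarith [hψB x]
  · intro x; linarith [hψ0 x]
  · rw [sub_nonneg, div_le_one (by positivity)]; linarith
  · linarith [show 0 < δ / (1 + B) by positivity]
  · intro x hx y
    rw [noiseAverage_add_mul γ a ε measurable_const hψc.measurable (C := |1 + B|)
      (fun _ => le_rfl) hψabs]
    have h1 : noiseAverage γ a ε (fun _ => 1 + B) y x = 1 + B := by simp [noiseAverage]
    rw [h1]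
    have h2 := hψD x hx y
    have h3 : δ / (1 + B) * (1 + B + -1 * ψ x) ≤ δ := by
      rw [div_mul_eq_mul_div, div_le_iff₀ (by positivity)]
      nlinarith [hψ0 x]
    linarith

/-! ### Existence and uniqueness for the dynamic programming principle -/

section Operator

variable {N : ℕ} {γ a ε κ M : ℝ} {D : Set (Space N)} {φ : Space N → ℝ}

/-- The error term does not depend on `y`, so it passes through both the infimum and the supremum.
-/
theorem averageOp_le_add (hγ : 0 < γ) (ha : 0 < a) (hε : 0 < ε)
    (hφ : IsDecreasingWeight γ a ε D κ M φ) {u v : Space N → ℝ} (hu : Measurable u)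
    (hv : Measurable v) {C C' : ℝ} (hC : ∀ x, |u x| ≤ C) (hC' : ∀ x, |v x| ≤ C') {K : ℝ}
    (hK : 0 ≤ K) (huv : ∀ x, u x ≤ v x + K * φ x) {x : Space N} (hx : x ∈ D) :
    averageOp γ a ε u x ≤ averageOp γ a ε v x + κ * K * φ x := by
  have key : ∀ y : UnitBall N,
      noiseAverage γ a ε u y x ≤ noiseAverage γ a ε v y x + κ * K * φ x := by
    intro y
    have hb : ∀ z, |v z + K * φ z| ≤ C' + K * M := fun z => by
      refine (abs_add_le _ _).trans (add_le_add (hC' z) ?_)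
      rw [abs_mul, abs_of_nonneg hK]
      exact mul_le_mul_of_nonneg_left (hφ.abs_le z) hK
    refine (noiseAverage_mono γ a ε hu (hv.add (hφ.continuous.measurable.const_mul K)) hC hb huv
      y x).trans ?_
    change noiseAverage γ a ε (fun z => v z + K * φ z) y x ≤ _
    rw [noiseAverage_add_mul γ a ε hv hφ.continuous.measurable hC' hφ.abs_le]
    nlinarith [mul_le_mul_of_nonneg_left (hφ.noiseAverage_le x hx y) hK]
  rw [averageOp_eq hγ ha hε, averageOp_eq hγ ha hε]
  have h1 : ⨆ y : UnitBall N, noiseAverage γ a ε u y x ≤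
      (⨆ y : UnitBall N, noiseAverage γ a ε v y x) + κ * K * φ x :=
    ciSup_le fun y => (key y).trans
      (add_le_add_left (le_ciSup (bddAbove_noiseAverage γ a ε hC' x) y) _)
  have h2 : (⨅ y : UnitBall N, noiseAverage γ a ε u y x) - κ * K * φ x ≤
      ⨅ y : UnitBall N, noiseAverage γ a ε v y x :=
    le_ciInf fun y => by
      linarith [key y, ciInf_le (bddBelow_noiseAverage γ a ε hC x) y]
  linarith

/-- The right-hand side of the dynamic programming principle. -/
noncomputable def dppOp (γ a : ℝ) (D : Set (Space N)) (F : Space N → ℝ) (ε : ℝ)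
    (u : Space N → ℝ) (x : Space N) : ℝ :=
  scaledDist D ε x * averageOp γ a ε u x + (1 - scaledDist D ε x) * F x

theorem abs_dppOp_le (hγ : 0 < γ) (ha : 0 < a) (hε : 0 < ε) {F u : Space N → ℝ} {C C' : ℝ}
    (hF : ∀ x, |F x| ≤ C) (hu : ∀ x, |u x| ≤ C') (x : Space N) :
    |dppOp γ a D F ε u x| ≤ C' + C := by
  have h0 := scaledDist_nonneg D hε x
  have h1 := scaledDist_le_one D hε x
  refine (abs_add_le _ _).trans (add_le_add ?_ ?_)
  · rw [abs_mul, abs_of_nonneg h0]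
    exact (mul_le_of_le_one_left (abs_nonneg _) h1).trans (abs_averageOp_le hγ ha hε hu x)
  · rw [abs_mul, abs_of_nonneg (by linarith)]
    exact (mul_le_of_le_one_left (abs_nonneg _) (by linarith)).trans (hF x)

/-- This is the contraction in the norm `sup |u| / φ`. Outside `D` the factor `scaledDist` vanishes,
so the decrease of the weight is needed in `D` only. -/
theorem abs_dppOp_sub_le (hγ : 0 < γ) (ha : 0 < a) (hε : 0 < ε)
    (hφ : IsDecreasingWeight γ a ε D κ M φ) {F u v : Space N → ℝ} (hu : Measurable u)
    (hv : Measurable v) {C C' : ℝ} (hC : ∀ x, |u x| ≤ C) (hC' : ∀ x, |v x| ≤ C') {K : ℝ}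
    (hK : 0 ≤ K) (huv : ∀ x, |u x - v x| ≤ K * φ x) (x : Space N) :
    |dppOp γ a D F ε u x - dppOp γ a D F ε v x| ≤ κ * K * φ x := by
  have hnn : 0 ≤ κ * K * φ x :=
    mul_nonneg (mul_nonneg hφ.rate_nonneg hK) (zero_le_one.trans (hφ.one_le x))
  have heq : dppOp γ a D F ε u x - dppOp γ a D F ε v x =
      scaledDist D ε x * (averageOp γ a ε u x - averageOp γ a ε v x) := by
    simp only [dppOp]; ring
  rw [heq]
  by_cases hx : x ∈ D
  · have h1 := averageOp_le_add hγ ha hε hφ hu hv hC hC' hK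
      (fun z => by linarith [(abs_le.1 (huv z)).2]) hx
    have h2 := averageOp_le_add hγ ha hε hφ hv hu hC' hC hK
      (fun z => by linarith [(abs_le.1 (huv z)).1]) hx
    rw [abs_mul, abs_of_nonneg (scaledDist_nonneg D hε x)]
    refine (mul_le_of_le_one_left (abs_nonneg _) (scaledDist_le_one D hε x)).trans ?_
    rw [_root_.abs_le]
    constructor <;> linarith
  · rw [scaledDist_eq_zero hε hx]
    simpa using hnn

/-- Both functions are fixed points, so the contraction can be iterated on their difference. Only
measurability and boundedness enter, not continuity. -/
theorem IsDPPSolution.unique (hγ : 0 < γ) (ha : 0 < a) (hε : 0 < ε)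
    (hφ : IsDecreasingWeight γ a ε D κ M φ) {F u v : Space N → ℝ}
    (hu : IsDPPSolution γ a D F ε u) (hv : IsDPPSolution γ a D F ε v) : v = u := by
  obtain ⟨C, hC⟩ := hu.bounded
  obtain ⟨C', hC'⟩ := hv.bounded
  have hK : 0 ≤ C' + C := by linarith [(abs_nonneg _).trans (hC 0), (abs_nonneg _).trans (hC' 0)]
  have key : ∀ n : ℕ, ∀ x, |v x - u x| ≤ κ ^ n * (C' + C) * φ x := by
    intro n
    induction n with
    | zero =>
      intro x
      rw [pow_zero, one_mul]
      exact ((abs_sub _ _).trans (add_le_add (hC' x) (hC x))).trans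
        (le_mul_of_one_le_right hK (hφ.one_le x))
    | succ n ih =>
      intro x
      have := abs_dppOp_sub_le (F := F) hγ ha hε hφ hv.measurable hu.measurable hC' hC
        (mul_nonneg (pow_nonneg hφ.rate_nonneg n) hK) ih x
      rw [hv.dpp x, hu.dpp x, pow_succ']
      simpa only [dppOp, mul_assoc] using this
  funext x
  have hlim : Filter.Tendsto (fun n : ℕ => κ ^ n * (C' + C) * φ x) Filter.atTop (nhds 0) := by
    simpa using ((tendsto_pow_atTop_nhds_zero_of_lt_one hφ.rate_nonneg
      hφ.rate_lt_one).mul_const (C' + C)).mul_const (φ x)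
  have := ge_of_tendsto' hlim fun n => key n x
  exact sub_eq_zero.1 (abs_nonpos_iff.1 this)

theorem exists_isDPPSolution (hγ : 0 < γ) (ha : 0 < a) (hε : 0 < ε)
    (hφ : IsDecreasingWeight γ a ε D κ M φ) {F : Space N → ℝ} (hF : Continuous F)
    (hFb : ∃ C, ∀ x, |F x| ≤ C) :
    ∃ u, IsDPPSolution γ a D F ε u ∧ Continuous u := by
  obtain ⟨C, hC⟩ := hFb
  have hpos : ∀ x, 0 < φ x := fun x => zero_lt_one.trans_le (hφ.one_le x)
  have hbound : ∀ (f : BoundedContinuousFunction (Space N) ℝ) (x : Space N),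
      |φ x * f x| ≤ M * ‖f‖ := by
    intro f x
    rw [abs_mul]
    exact mul_le_mul (hφ.abs_le x) (f.norm_coe_le_norm x) (abs_nonneg _)
      ((abs_nonneg _).trans (hφ.abs_le x))
  have hcont : ∀ f : BoundedContinuousFunction (Space N) ℝ, Continuous fun x => φ x * f x :=
    fun f => hφ.continuous.mul f.continuous
  have hTcont : ∀ f : BoundedContinuousFunction (Space N) ℝ,
      Continuous (dppOp γ a D F ε fun x => φ x * f x) := fun f =>
    ((continuous_scaledDist D ε).mul (continuous_averageOp hγ ha hε (hcont f) (hbound f))).add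
      ((continuous_const.sub (continuous_scaledDist D ε)).mul hF)
  -- Writing `u = φ f` turns the weighted norm of `u` into the sup norm of `f`, for which bounded
  -- continuous functions are complete.
  let T : BoundedContinuousFunction (Space N) ℝ → BoundedContinuousFunction (Space N) ℝ := fun f =>
    .ofNormedAddCommGroup (fun x => dppOp γ a D F ε (fun z => φ z * f z) x / φ x)
      ((hTcont f).div hφ.continuous fun x => (hpos x).ne') (M * ‖f‖ + C) fun x => by
        rw [Real.norm_eq_abs, abs_div]
        refine (div_le_self (abs_nonneg _) ?_).trans (abs_dppOp_le hγ ha hε hC (hbound f) x)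
        exact (hφ.one_le x).trans (le_abs_self _)
  have hT : ContractingWith ⟨κ, hφ.rate_nonneg⟩ T := by
    refine ⟨hφ.rate_lt_one, LipschitzWith.of_dist_le_mul fun f g => ?_⟩
    refine (BoundedContinuousFunction.dist_le (mul_nonneg hφ.rate_nonneg dist_nonneg)).2
      fun x => ?_
    have := abs_dppOp_sub_le (F := F) hγ ha hε hφ (hcont f).measurable (hcont g).measurable
      (hbound f) (hbound g) (dist_nonneg (x := f) (y := g)) (fun z => by
        rw [← mul_sub, abs_mul, abs_of_pos (hpos z), mul_comm]
        exact mul_le_mul_of_nonneg_right (f.dist_coe_le_dist z) (hpos z).le) x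
    change |_ / φ x - _ / φ x| ≤ κ * dist f g
    rw [← sub_div, abs_div, abs_of_pos (hpos x), div_le_iff₀ (hpos x)]
    exact this
  let f := ContractingWith.fixedPoint T hT
  have hf : T f = f := hT.fixedPoint_isFixedPt
  refine ⟨fun x => φ x * f x, ⟨(hcont f).measurable, ⟨_, hbound f⟩, fun x => ?_⟩, hcont f⟩
  have h1 : dppOp γ a D F ε (fun z => φ z * f z) x / φ x = f x := DFunLike.congr_fun hf x
  rw [div_eq_iff (hpos x).ne'] at h1
  rw [mul_comm, ← h1]
  rfl

end Operator

end TugOfWar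

/-! ### Resampling one turn -/

/-- Resampling one coordinate of an infinite product of copies of a probability measure preserves
the product measure. -/
theorem MeasureTheory.measurePreserving_update_infinitePi {α : Type*} [MeasurableSpace α]
    (μ : Measure α) [IsProbabilityMeasure μ] (n : ℕ) :
    MeasurePreserving (fun q : (ℕ → α) × α => Function.update q.1 n q.2)
      ((Measure.infinitePi fun _ : ℕ => μ).prod μ) (Measure.infinitePi fun _ : ℕ => μ) := by
  classical
  have hm : Measurable fun q : (ℕ → α) × α => Function.update q.1 n q.2 := by
    refine measurable_pi_lambda _ fun i => ?_
    by_cases hi : i = n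
    · subst hi
      simpa using measurable_snd
    · simpa [Function.update_of_ne hi, Function.comp_def] using
        (measurable_pi_apply (X := fun _ : ℕ => α) i).comp measurable_fst
  refine ⟨hm, Measure.eq_infinitePi _ fun s t ht => ?_⟩
  rw [Measure.map_apply hm (.pi s.countable_toSet fun i _ => ht i)]
  by_cases hn : n ∈ s
  · have hpre : (fun q : (ℕ → α) × α => Function.update q.1 n q.2) ⁻¹' (s : Set ℕ).pi t =
        ((s.erase n : Finset ℕ) : Set ℕ).pi t ×ˢ t n := by
      ext ⟨f, x⟩
      simp only [mem_preimage, mem_pi, Finset.mem_coe, mem_prod, Finset.mem_erase]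
      constructor
      · intro h
        exact ⟨fun i hi => by simpa [hi.1] using h i hi.2, by simpa using h n hn⟩
      · rintro ⟨h1, h2⟩ i hi
        by_cases hin : i = n
        · subst hin; simpa using h2
        · simpa [hin] using h1 i ⟨hin, hi⟩
    rw [hpre, Measure.prod_prod, Measure.infinitePi_pi _ fun i _ => ht i,
      Finset.prod_erase_mul s _ hn]
  · have hpre : (fun q : (ℕ → α) × α => Function.update q.1 n q.2) ⁻¹' (s : Set ℕ).pi t =
        (s : Set ℕ).pi t ×ˢ univ := by
      ext ⟨f, x⟩
      simp only [mem_preimage, mem_pi, Finset.mem_coe, mem_prod, mem_univ, and_true]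
      refine forall₂_congr fun i hi => ?_
      rw [Function.update_of_ne (ne_of_mem_of_not_mem hi hn)]
    rw [hpre, Measure.prod_prod, Measure.infinitePi_pi _ fun i _ => ht i, measure_univ, mul_one]

namespace TugOfWar

instance (N : ℕ) : IsProbabilityMeasure (gameLaw N) := by
  unfold gameLaw
  infer_instance

/-- This plays the role of conditioning on all turns except the one stored at index `n`. -/
theorem integral_update_gameLaw {N : ℕ} (n : ℕ) {f : Omega N → ℝ}
    (hf : Integrable f (gameLaw N)) :
    ∫ ω, f ω ∂gameLaw N = ∫ ω, ∫ o, f (Function.update ω n o) ∂outcomeLaw N ∂gameLaw N := by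
  have hmp := measurePreserving_update_infinitePi (outcomeLaw N) n
  change MeasurePreserving _ ((gameLaw N).prod (outcomeLaw N)) (gameLaw N) at hmp
  rw [← integral_prod (fun q : Omega N × Outcome N => f (Function.update q.1 n q.2))
    (hmp.integrable_comp_of_integrable hf)]
  conv_lhs => rw [← hmp.map_eq]
  exact integral_map hmp.measurable.aemeasurable (by rw [hmp.map_eq]; exact hf.aestronglyMeasurable)

/-! ### The expectation over one turn -/

theorem integral_coinLaw (f : Bool → ℝ) : ∫ b, f b ∂coinLaw = (1 / 2) * (f true + f false) := by
  rw [coinLaw, integral_smul_measure, integral_count, Fintype.sum_bool, smul_eq_mul]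
  simp

theorem thresholdLaw_real_le {d : ℝ} (h0 : 0 ≤ d) (h1 : d ≤ 1) :
    thresholdLaw.real {t : Ioo (0 : ℝ) 1 | (t : ℝ) ≤ d} = d := by
  have himg : Subtype.val '' {t : Ioo (0 : ℝ) 1 | (t : ℝ) ≤ d} = Ioo (0 : ℝ) 1 ∩ Iic d :=
    Subtype.image_preimage_coe (Ioo (0 : ℝ) 1) (Iic d)
  rw [measureReal_def, thresholdLaw, comap_subtype_coe_apply measurableSet_Ioo, himg,
    measure_congr (Ioo_ae_eq_Ioc.inter (ae_eq_refl (Iic d))), Ioc_inter_Iic, min_eq_right h1,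
    Real.volume_Ioc, sub_zero, ENNReal.toReal_ofReal h0]

theorem integral_thresholdLaw {d : ℝ} (h0 : 0 ≤ d) (h1 : d ≤ 1) (A B : ℝ) :
    ∫ t : Ioo (0 : ℝ) 1, (if (t : ℝ) ≤ d then A else B) ∂thresholdLaw = d * A + (1 - d) * B := by
  have hm : MeasurableSet {t : Ioo (0 : ℝ) 1 | (t : ℝ) ≤ d} :=
    measurableSet_le measurable_subtype_coe measurable_const
  have heq : (fun t : Ioo (0 : ℝ) 1 => if (t : ℝ) ≤ d then A else B) =
      fun t => {t : Ioo (0 : ℝ) 1 | (t : ℝ) ≤ d}.indicator (fun _ => A - B) t + B := by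
    funext t
    by_cases ht : (t : ℝ) ≤ d <;> simp [ht]
  rw [heq, integral_add ((integrable_const _).indicator hm) (integrable_const _),
    integral_indicator_const _ hm, thresholdLaw_real_le h0 h1]
  simp
  ring

section Game

variable {N : ℕ} (γ a : ℝ) (D : Set (Space N)) (ε : ℝ) (x₀ : Space N) (σI σII : Strategy N)

theorem measurable_position {n : ℕ} : Measurable (History.position : History N n → Space N) := by
  cases n with
  | zero => exact measurable_fst
  | succ n => exact ((measurable_pi_apply (Fin.last n)).comp measurable_snd).fst

theorem measurable_nextPosition (n : ℕ) :
    Measurable fun q : History N n × Outcome N => nextPosition γ a ε σI σII q.1 q.2 := by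
  have hy : Measurable fun q : History N n × Outcome N =>
      ((bif q.2.2.1 then σI.toFun n q.1 else σII.toFun n q.1 : UnitBall N) : Space N) := by
    refine measurable_subtype_coe.comp ?_
    simp only [cond_eq_ite]
    exact Measurable.ite
      (measurable_snd.snd.fst (measurableSet_singleton true))
      ((σI.measurable_toFun n).comp measurable_fst) ((σII.measurable_toFun n).comp measurable_fst)
  have hw : Measurable fun q : History N n × Outcome N => (q.2.1 : Space N) :=
    measurable_subtype_coe.comp measurable_snd.fst
  exact (measurable_position.comp measurable_fst).add
    (((continuous_shift γ a).measurable.comp (hy.prodMk hw)).const_smul ε)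

/-- The expected value after one turn that starts with the history `h`: the game continues with
probability `d_ε`, and then the value of the new position is given by `v`; otherwise it is given
by `G` at the old one. -/
noncomputable def turnValue (v G : Space N → ℝ) {n : ℕ} (h : History N n) : ℝ :=
  scaledDist D ε h.position * ((1 / 2) * (noiseAverage γ a ε v (σI.toFun n h) h.position +
    noiseAverage γ a ε v (σII.toFun n h) h.position)) +
    (1 - scaledDist D ε h.position) * G h.position

variable {ε} in
theorem integral_outcomeLaw (hε : 0 < ε) {v : Space N → ℝ} (hv : Measurable v) {C : ℝ}
    (hC : ∀ x, |v x| ≤ C) (G : Space N → ℝ) {n : ℕ} (h : History N n) :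
    ∫ o : Outcome N, (if (o.2.2 : ℝ) ≤ scaledDist D ε h.position then
      v (nextPosition γ a ε σI σII h o) else G h.position) ∂outcomeLaw N =
    turnValue γ a D ε σI σII v G h := by
  have h0 := scaledDist_nonneg D hε h.position
  have h1 := scaledDist_le_one D hε h.position
  rw [turnValue]
  set d := scaledDist D ε h.position
  set c := G h.position
  have hfm : Measurable fun o : Outcome N => if (o.2.2 : ℝ) ≤ d then
      v (nextPosition γ a ε σI σII h o) else c :=
    Measurable.ite (measurableSet_le (measurable_subtype_coe.comp measurable_snd.snd)
      measurable_const)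
      (hv.comp ((measurable_nextPosition γ a ε σI σII n).comp measurable_prodMk_left))
      measurable_const
  have hfb : ∀ o : Outcome N, ‖if (o.2.2 : ℝ) ≤ d then
      v (nextPosition γ a ε σI σII h o) else c‖ ≤ max C |c| := by
    intro o
    split_ifs
    · exact (hC _).trans (le_max_left _ _)
    · exact le_max_right _ _
  -- For fixed noise, the threshold gives the weights `d` and `1 - d`, and the coin gives the two
  -- halves.
  have inner_integral : ∀ w : UnitBall N, ∫ z : Bool × Ioo (0 : ℝ) 1, (if (z.2 : ℝ) ≤ d then
      v (nextPosition γ a ε σI σII h (w, z)) else c) ∂coinLaw.prod thresholdLaw =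
      (d * (1 / 2)) * v (h.position + ε • shift γ a (σI.toFun n h) w) +
        (d * (1 / 2)) * v (h.position + ε • shift γ a (σII.toFun n h) w) + (1 - d) * c := by
    intro w
    have hint : Integrable (fun z : Bool × Ioo (0 : ℝ) 1 => if (z.2 : ℝ) ≤ d then
        v (nextPosition γ a ε σI σII h (w, z)) else c) (coinLaw.prod thresholdLaw) :=
      .of_bound (hfm.comp measurable_prodMk_left).aestronglyMeasurable
        (max C |c|) (.of_forall fun z => hfb (w, z))
    rw [integral_prod _ hint]
    simp only [nextPosition, integral_thresholdLaw h0 h1, integral_coinLaw, cond_true, cond_false]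
    ring
  rw [outcomeLaw, integral_prod _ (.of_bound hfm.aestronglyMeasurable _ (.of_forall hfb))]
  simp only [inner_integral]
  have hi := fun y => integrable_noise γ a ε hv hC y h.position
  have hi' := fun y => (hi y).const_mul (d * (1 / 2))
  rw [integral_add (by exact (hi' _).add (hi' _)) (integrable_const _),
    integral_add (hi' _) (hi' _), integral_const_mul, integral_const_mul]
  simp [noiseAverage]
  ring

/-! ### The game up to turn `n` -/

theorem measurable_gameHistory (n : ℕ) :
    Measurable fun ω => gameHistory γ a ε x₀ σI σII ω n := by
  induction n with
  | zero => exact measurable_const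
  | succ n ih =>
    refine measurable_const.prodMk (measurable_pi_lambda _ fun i => ?_)
    refine Fin.lastCases ?_ (fun j => ?_) i
    · simp only [Fin.snoc_last]
      exact ((measurable_nextPosition γ a ε σI σII n).comp
        (ih.prodMk (measurable_pi_apply n))).prodMk (measurable_pi_apply n)
    · simp only [Fin.snoc_castSucc]
      exact (measurable_pi_apply j).comp ih.snd

theorem measurable_process (n : ℕ) : Measurable (process γ a ε x₀ σI σII n) :=
  measurable_position.comp (measurable_gameHistory γ a ε x₀ σI σII n)

theorem process_succ (n : ℕ) (ω : Omega N) :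
    process γ a ε x₀ σI σII (n + 1) ω =
      nextPosition γ a ε σI σII (gameHistory γ a ε x₀ σI σII ω n) (ω n) := by
  simp [process, gameHistory, History.position]

/-- The history after `m` turns reads only the entries of `ω` with index below `m`; hence `m = n` is
allowed. -/
theorem gameHistory_update (ω : Omega N) (o : Outcome N) {m n : ℕ} (hmn : m ≤ n) :
    gameHistory γ a ε x₀ σI σII (Function.update ω n o) m = gameHistory γ a ε x₀ σI σII ω m := by
  induction m with
  | zero => rfl
  | succ m ih =>
    simp only [gameHistory, ih (Nat.le_of_succ_le hmn), Function.update_of_ne (Nat.ne_of_lt hmn)]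

theorem process_update (ω : Omega N) (o : Outcome N) {m n : ℕ} (hmn : m ≤ n) :
    process γ a ε x₀ σI σII m (Function.update ω n o) = process γ a ε x₀ σI σII m ω := by
  rw [process, gameHistory_update γ a ε x₀ σI σII ω o hmn, process]

/-- The event that the game is still running after `n` turns. -/
def inPlay (n : ℕ) : Set (Omega N) :=
  {ω | ∀ k < n, ((ω k).2.2 : ℝ) ≤ scaledDist D ε (process γ a ε x₀ σI σII k ω)}

theorem measurableSet_continues (n : ℕ) : MeasurableSet {ω : Omega N |
    ((ω n).2.2 : ℝ) ≤ scaledDist D ε (process γ a ε x₀ σI σII n ω)} :=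
  measurableSet_le (measurable_subtype_coe.comp (measurable_pi_apply n).snd.snd)
    ((continuous_scaledDist D ε).measurable.comp (measurable_process γ a ε x₀ σI σII n))

theorem measurableSet_inPlay (n : ℕ) : MeasurableSet (inPlay γ a D ε x₀ σI σII n) := by
  have : inPlay γ a D ε x₀ σI σII n = ⋂ k, ⋂ (_ : k < n), {ω : Omega N |
      ((ω k).2.2 : ℝ) ≤ scaledDist D ε (process γ a ε x₀ σI σII k ω)} := by
    ext ω
    simp [inPlay]
  rw [this]
  exact .iInter fun k => .iInter fun _ => measurableSet_continues γ a D ε x₀ σI σII k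

theorem mem_inPlay_succ (n : ℕ) (ω : Omega N) :
    ω ∈ inPlay γ a D ε x₀ σI σII (n + 1) ↔ ω ∈ inPlay γ a D ε x₀ σI σII n ∧
      ((ω n).2.2 : ℝ) ≤ scaledDist D ε (process γ a ε x₀ σI σII n ω) := by
  simp only [inPlay, mem_ofPred_eq, Nat.lt_succ_iff_lt_or_eq, or_imp, forall_and, forall_eq]

theorem update_mem_inPlay (n : ℕ) (ω : Omega N) (o : Outcome N) :
    Function.update ω n o ∈ inPlay γ a D ε x₀ σI σII n ↔ ω ∈ inPlay γ a D ε x₀ σI σII n := by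
  simp only [inPlay, mem_ofPred_eq]
  refine forall₂_congr fun k hk => ?_
  rw [process_update γ a ε x₀ σI σII ω o hk.le, Function.update_of_ne hk.ne]

/-- The value after turn `n + 1` of a game that is running after `n` turns: `v` at the new position
if the game continues and `G` at the old position if it stops. -/
noncomputable def turnOutcome (v G : Space N → ℝ) (n : ℕ) (ω : Omega N) : ℝ :=
  if ((ω n).2.2 : ℝ) ≤ scaledDist D ε (process γ a ε x₀ σI σII n ω) then
    v (process γ a ε x₀ σI σII (n + 1) ω) else G (process γ a ε x₀ σI σII n ω)

theorem integrable_turnOutcome {v G : Space N → ℝ} (hv : Measurable v)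
    (hG : Measurable G) {C C' : ℝ} (hC : ∀ x, |v x| ≤ C) (hC' : ∀ x, |G x| ≤ C') (n : ℕ) :
    Integrable (turnOutcome γ a D ε x₀ σI σII v G n) (gameLaw N) := by
  refine .of_bound (C := max C C') (Measurable.ite (measurableSet_continues γ a D ε x₀ σI σII n)
    (hv.comp (measurable_process γ a ε x₀ σI σII (n + 1)))
    (hG.comp (measurable_process γ a ε x₀ σI σII n))).aestronglyMeasurable (.of_forall fun ω => ?_)
  rw [turnOutcome]
  split_ifs
  · exact (hC _).trans (le_max_left _ _)
  · exact (hC' _).trans (le_max_right _ _)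

variable {ε} in
-- Both the event of being in play and the history after `n` turns ignore `ω n`. Resampling that
-- entry therefore replaces the outcome of the turn by its expectation given the history.
theorem integral_inPlay_turnOutcome (hε : 0 < ε) {v G : Space N → ℝ} (hv : Measurable v)
    (hG : Measurable G) {C C' : ℝ} (hC : ∀ x, |v x| ≤ C) (hC' : ∀ x, |G x| ≤ C') (n : ℕ) :
    ∫ ω, (inPlay γ a D ε x₀ σI σII n).indicator (turnOutcome γ a D ε x₀ σI σII v G n) ω
      ∂gameLaw N =
    ∫ ω, (inPlay γ a D ε x₀ σI σII n).indicator
      (fun ω => turnValue γ a D ε σI σII v G (gameHistory γ a ε x₀ σI σII ω n)) ω ∂gameLaw N := by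
  rw [integral_update_gameLaw n ((integrable_turnOutcome γ a D ε x₀ σI σII hv hG hC hC'
    n).indicator (measurableSet_inPlay γ a D ε x₀ σI σII n))]
  refine integral_congr_ae (.of_forall fun ω => ?_)
  simp only
  by_cases hω : ω ∈ inPlay γ a D ε x₀ σI σII n
  · rw [indicator_of_mem hω, ← integral_outcomeLaw γ a D σI σII hε hv hC G]
    refine integral_congr_ae (.of_forall fun o => ?_)
    simp only
    rw [indicator_of_mem ((update_mem_inPlay γ a D ε x₀ σI σII n ω o).2 hω), turnOutcome,
      process_succ, process_update γ a ε x₀ σI σII ω o le_rfl,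
      gameHistory_update γ a ε x₀ σI σII ω o le_rfl, Function.update_self]
    rfl
  · rw [indicator_of_notMem hω]
    have : ∀ o, (inPlay γ a D ε x₀ σI σII n).indicator
        (turnOutcome γ a D ε x₀ σI σII v G n) (Function.update ω n o) = 0 := fun o =>
      indicator_of_notMem (mt (update_mem_inPlay γ a D ε x₀ σI σII n ω o).1 hω) _
    simp [this]

end Game

/-! ### The game stops almost surely -/

section Stopping

variable {N : ℕ} (γ a : ℝ) (D : Set (Space N)) (ε : ℝ) (x₀ : Space N) (σI σII : Strategy N)

theorem stoppingTime_lt_top_of_notMem {n : ℕ} {ω : Omega N}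
    (h : ω ∉ inPlay γ a D ε x₀ σI σII n) : stoppingTime γ a D ε x₀ σI σII ω < ⊤ := by
  simp only [inPlay, mem_ofPred_eq, not_forall, not_le] at h
  obtain ⟨k, -, hk⟩ := h
  exact (iInf₂_le (f := fun (m : ℕ) (_ : scaledDist D ε (process γ a ε x₀ σI σII m ω) <
    ((ω m).2.2 : ℝ)) => ((m + 1 : ℕ) : ℕ∞)) k hk).trans_lt (ENat.natCast_lt_top _)

theorem stoppingTime_eq {n : ℕ} {ω : Omega N} (h : ω ∈ inPlay γ a D ε x₀ σI σII n)
    (hn : scaledDist D ε (process γ a ε x₀ σI σII n ω) < ((ω n).2.2 : ℝ)) :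
    stoppingTime γ a D ε x₀ σI σII ω = ((n + 1 : ℕ) : ℕ∞) := by
  refine le_antisymm (iInf₂_le (f := fun (m : ℕ) (_ : scaledDist D ε
    (process γ a ε x₀ σI σII m ω) < ((ω m).2.2 : ℝ)) => ((m + 1 : ℕ) : ℕ∞)) n hn)
    (le_iInf₂ fun m hm => ?_)
  have hnm : n ≤ m := not_lt.1 fun hlt => (h m hlt).not_gt hm
  exact_mod_cast Nat.succ_le_succ hnm

theorem payoff_eq (F : Space N → ℝ) {n : ℕ} {ω : Omega N}
    (h : ω ∈ inPlay γ a D ε x₀ σI σII n)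
    (hn : scaledDist D ε (process γ a ε x₀ σI σII n ω) < ((ω n).2.2 : ℝ)) :
    payoff γ a D F ε x₀ σI σII ω = F (process γ a ε x₀ σI σII n ω) := by
  rw [payoff, stoppingTime_eq γ a D ε x₀ σI σII h hn, ENat.toNat_natCast, Nat.add_sub_cancel]

theorem measurable_stoppingTime : Measurable (stoppingTime γ a D ε x₀ σI σII) := by
  classical
  -- Since `ℕ∞` is countable, its Borel sets are all its subsets.
  have : BorelSpace ℕ∞ := ⟨by rw [borel_eq_top_of_countable]; rfl⟩
  refine Measurable.iInf fun m => ?_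
  simp only [iInf_eq_if]
  refine Measurable.ite ?_ measurable_const measurable_const
  exact measurableSet_lt
    ((continuous_scaledDist D ε).measurable.comp (measurable_process γ a ε x₀ σI σII m))
    (measurable_subtype_coe.comp (measurable_pi_apply m).snd.snd)

theorem measurable_payoff {F : Space N → ℝ} (hF : Measurable F) :
    Measurable (payoff γ a D F ε x₀ σI σII) := by
  have hT : Measurable fun ω => (stoppingTime γ a D ε x₀ σI σII ω).toNat - 1 :=
    (measurable_of_countable fun t : ℕ∞ => t.toNat - 1).comp
      (measurable_stoppingTime γ a D ε x₀ σI σII)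
  have hX : Measurable fun q : ℕ × Omega N => process γ a ε x₀ σI σII q.1 q.2 :=
    measurable_from_prod_countable_right fun n => measurable_process γ a ε x₀ σI σII n
  exact hF.comp (hX.comp (hT.prodMk measurable_id))

theorem integrable_payoff {F : Space N → ℝ} (hF : Measurable F) {C : ℝ} (hC : ∀ x, |F x| ≤ C) :
    Integrable (payoff γ a D F ε x₀ σI σII) (gameLaw N) :=
  .of_bound (measurable_payoff γ a D ε x₀ σI σII hF).aestronglyMeasurable C
    (.of_forall fun _ => hC _)

theorem measurable_turnValue {v G : Space N → ℝ} (hv : Continuous v) (hG : Measurable G) {C : ℝ}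
    (hC : ∀ x, |v x| ≤ C) (n : ℕ) :
    Measurable fun h : History N n => turnValue γ a D ε σI σII v G h := by
  have hpos := measurable_position (N := N) (n := n)
  have hd := (continuous_scaledDist D ε).measurable.comp hpos
  have hg : ∀ σ : Strategy N, Measurable fun h : History N n =>
      noiseAverage γ a ε v (σ.toFun n h) h.position := fun σ =>
    (continuous_noiseAverage γ a ε hv hC).measurable.comp
      ((measurable_subtype_coe.comp (σ.measurable_toFun n)).prodMk hpos)
  exact (hd.mul (((hg σI).add (hg σII)).const_mul _)).add
    ((measurable_const.sub hd).mul (hG.comp hpos))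

variable {ε}

theorem abs_turnValue_le (hε : 0 < ε) {v G : Space N → ℝ} {C C' : ℝ}
    (hC : ∀ x, |v x| ≤ C) (hC' : ∀ x, |G x| ≤ C') {n : ℕ} (h : History N n) :
    |turnValue γ a D ε σI σII v G h| ≤ C + C' := by
  have h0 := scaledDist_nonneg D hε h.position
  have h1 := scaledDist_le_one D hε h.position
  have hg := fun y => abs_le.1 (abs_noiseAverage_le γ a ε hC y h.position)
  refine (abs_add_le _ _).trans (add_le_add ?_ ?_)
  · rw [abs_mul, abs_of_nonneg h0]
    refine (mul_le_of_le_one_left (abs_nonneg _) h1).trans (abs_le.2 ⟨?_, ?_⟩)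
    · linarith [(hg (σI.toFun n h)).1, (hg (σII.toFun n h)).1]
    · linarith [(hg (σI.toFun n h)).2, (hg (σII.toFun n h)).2]
  · rw [abs_mul, abs_of_nonneg (by linarith)]
    exact (mul_le_of_le_one_left (abs_nonneg _) (by linarith)).trans (hC' _)

theorem integrable_turnValue (hε : 0 < ε) {v G : Space N → ℝ} (hv : Continuous v)
    (hG : Measurable G) {C C' : ℝ} (hC : ∀ x, |v x| ≤ C) (hC' : ∀ x, |G x| ≤ C') (n : ℕ) :
    Integrable (fun ω => turnValue γ a D ε σI σII v G (gameHistory γ a ε x₀ σI σII ω n))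
      (gameLaw N) :=
  .of_bound ((measurable_turnValue γ a D ε σI σII hv hG hC n).comp
    (measurable_gameHistory γ a ε x₀ σI σII n)).aestronglyMeasurable (C + C')
    (.of_forall fun _ => abs_turnValue_le γ a D σI σII hε hC hC' _)

theorem integrable_process {v : Space N → ℝ} (hv : Measurable v) {C : ℝ} (hC : ∀ x, |v x| ≤ C)
    (n : ℕ) : Integrable (fun ω => v (process γ a ε x₀ σI σII n ω)) (gameLaw N) :=
  .of_bound (hv.comp (measurable_process γ a ε x₀ σI σII n)).aestronglyMeasurable C
    (.of_forall fun _ => hC _)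

variable {γ a D} {κ M : ℝ} {φ : Space N → ℝ}

/-- The terminal value `0` discards games that stop; outside `D` every game stops. -/
theorem turnValue_weight_le (hε : 0 < ε) (hφ : IsDecreasingWeight γ a ε D κ M φ) {n : ℕ}
    (h : History N n) :
    turnValue γ a D ε σI σII φ (fun _ => 0) h ≤ κ * φ h.position := by
  have hnn : 0 ≤ κ * φ h.position :=
    mul_nonneg hφ.rate_nonneg (zero_le_one.trans (hφ.one_le _))
  rw [turnValue, mul_zero, add_zero]
  by_cases hx : h.position ∈ D
  · have h1 := hφ.noiseAverage_le _ hx (σI.toFun n h)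
    have h2 := hφ.noiseAverage_le _ hx (σII.toFun n h)
    calc _ ≤ scaledDist D ε h.position * (κ * φ h.position) :=
          mul_le_mul_of_nonneg_left (by linarith) (scaledDist_nonneg D hε _)
      _ ≤ _ := mul_le_of_le_one_left hnn (scaledDist_le_one D hε _)
  · rwa [scaledDist_eq_zero hε hx, zero_mul]

theorem integral_weight_inPlay_le (hε : 0 < ε) (hφ : IsDecreasingWeight γ a ε D κ M φ) (n : ℕ) :
    ∫ ω, (inPlay γ a D ε x₀ σI σII n).indicator (fun ω => φ (process γ a ε x₀ σI σII n ω)) ω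
      ∂gameLaw N ≤ κ ^ n * φ x₀ := by
  have hφm := hφ.continuous.measurable
  induction n with
  | zero =>
    have : inPlay γ a D ε x₀ σI σII 0 = univ := by ext; simp [inPlay]
    simp [this, process, gameHistory, History.position]
  | succ n ih =>
    -- With terminal value `0`, the turn outcome itself records whether the game goes on.
    have hstep : ∀ ω, (inPlay γ a D ε x₀ σI σII (n + 1)).indicator
        (fun ω => φ (process γ a ε x₀ σI σII (n + 1) ω)) ω =
        (inPlay γ a D ε x₀ σI σII n).indicator
          (turnOutcome γ a D ε x₀ σI σII φ (fun _ => 0) n) ω := by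
      intro ω
      have hmem := mem_inPlay_succ γ a D ε x₀ σI σII n ω
      by_cases hω : ω ∈ inPlay γ a D ε x₀ σI σII n
      · by_cases ht : ((ω n).2.2 : ℝ) ≤ scaledDist D ε (process γ a ε x₀ σI σII n ω)
        · rw [indicator_of_mem (hmem.2 ⟨hω, ht⟩), indicator_of_mem hω, turnOutcome, if_pos ht]
        · rw [indicator_of_notMem fun h => ht (hmem.1 h).2, indicator_of_mem hω, turnOutcome,
            if_neg ht]
      · rw [indicator_of_notMem fun h => hω (hmem.1 h).1, indicator_of_notMem hω]
    rw [integral_congr_ae (.of_forall hstep), integral_inPlay_turnOutcome γ a D x₀ σI σII hε hφm measurable_const hφ.abs_le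
      (C' := 0) (by simp)]
    have hm := measurableSet_inPlay γ a D ε x₀ σI σII n
    calc _ ≤ ∫ ω, κ * (inPlay γ a D ε x₀ σI σII n).indicator
            (fun ω => φ (process γ a ε x₀ σI σII n ω)) ω ∂gameLaw N := by
          refine integral_mono ((integrable_turnValue γ a D x₀ σI σII hε hφ.continuous
            measurable_const hφ.abs_le (C' := 0) (by simp) n).indicator hm)
            (((integrable_process γ a x₀ σI σII hφm hφ.abs_le n).indicator hm).const_mul κ)
            fun ω => ?_
          by_cases hω : ω ∈ inPlay γ a D ε x₀ σI σII n
          · simp only [indicator_of_mem hω]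
            exact turnValue_weight_le σI σII hε hφ (gameHistory γ a ε x₀ σI σII ω n)
          · simp [hω]
      _ ≤ κ * (κ ^ n * φ x₀) := by
          rw [integral_const_mul]
          exact mul_le_mul_of_nonneg_left ih hφ.rate_nonneg
      _ = _ := by ring

/-- Because `φ ≥ 1`, the expected weight of running games bounds their probability. -/
theorem measureReal_inPlay_le (hε : 0 < ε) (hφ : IsDecreasingWeight γ a ε D κ M φ) (n : ℕ) :
    (gameLaw N).real (inPlay γ a D ε x₀ σI σII n) ≤ κ ^ n * φ x₀ := by
  have hm := measurableSet_inPlay γ a D ε x₀ σI σII n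
  refine le_trans ?_ (integral_weight_inPlay_le x₀ σI σII hε hφ n)
  rw [← integral_indicator_one hm]
  exact integral_mono ((integrable_const (1 : ℝ)).indicator hm)
    ((integrable_process γ a x₀ σI σII hφ.continuous.measurable hφ.abs_le n).indicator hm)
    fun ω => indicator_le_indicator (hφ.one_le _)

theorem tendsto_measureReal_inPlay (hε : 0 < ε) (hφ : IsDecreasingWeight γ a ε D κ M φ) :
    Filter.Tendsto (fun n => (gameLaw N).real (inPlay γ a D ε x₀ σI σII n)) Filter.atTop
      (nhds 0) := by
  refine squeeze_zero (fun _ => measureReal_nonneg)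
    (fun n => measureReal_inPlay_le x₀ σI σII hε hφ n) ?_
  simpa using (tendsto_pow_atTop_nhds_zero_of_lt_one hφ.rate_nonneg hφ.rate_lt_one).mul_const
    (φ x₀)

theorem ae_stoppingTime_lt_top (hε : 0 < ε) (hφ : IsDecreasingWeight γ a ε D κ M φ) :
    ∀ᵐ ω ∂gameLaw N, stoppingTime γ a D ε x₀ σI σII ω < ⊤ := by
  have hsub : ∀ n, {ω | ¬stoppingTime γ a D ε x₀ σI σII ω < ⊤} ⊆ inPlay γ a D ε x₀ σI σII n :=
    fun n ω hω => by_contra fun h => hω (stoppingTime_lt_top_of_notMem γ a D ε x₀ σI σII h)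
  have hle := ge_of_tendsto' (tendsto_measureReal_inPlay x₀ σI σII hε hφ)
    fun n => measureReal_mono (hsub n)
  rw [ae_iff]
  exact (measureReal_eq_zero_iff).1 (le_antisymm hle measureReal_nonneg)

/-! ### The value of the game -/

/-- The hypothesis `hle` is a submartingale inequality: the value `v` of the running game, replaced
by the payoff once stopped, does not decrease in expectation. It starts at `v x₀` and tends to the
expected payoff, as the probability of still playing tends to zero. -/
theorem le_expectedPayoff (hε : 0 < ε) (hφ : IsDecreasingWeight γ a ε D κ M φ)
    {F v : Space N → ℝ} (hF : Measurable F) (hv : Continuous v) {C C' : ℝ} (hC : ∀ x, |v x| ≤ C)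
    (hC' : ∀ x, |F x| ≤ C')
    (hle : ∀ (n : ℕ) (h : History N n), v h.position ≤ turnValue γ a D ε σI σII v F h) :
    v x₀ ≤ expectedPayoff γ a D F ε x₀ σI σII := by
  classical
  have hm := measurableSet_inPlay γ a D ε x₀ σI σII
  set A := inPlay γ a D ε x₀ σI σII with hA
  set P := payoff γ a D F ε x₀ σI σII with hP
  have hPi : Integrable P (gameLaw N) := integrable_payoff γ a D ε x₀ σI σII hF hC'
  have hvi := integrable_process γ a (ε := ε) x₀ σI σII hv.measurable hC
  have hto := integrable_turnOutcome γ a D ε x₀ σI σII hv.measurable hF hC hC'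
  have htv := integrable_turnValue γ a D x₀ σI σII hε hv hF hC hC'
  -- This equals `v` at the current position while the game runs and the payoff afterwards.
  let S : ℕ → Omega N → ℝ := fun n ω =>
    P ω + (A n).indicator (fun ω => v (process γ a ε x₀ σI σII n ω) - P ω) ω
  have hSi : ∀ n, Integrable (S n) (gameLaw N) := fun n =>
    hPi.add (((hvi n).sub hPi).indicator (hm n))
  have hstep : ∀ n ω, S (n + 1) ω = S n ω +
      ((A n).indicator (turnOutcome γ a D ε x₀ σI σII v F n) ω -
        (A n).indicator (fun ω => v (process γ a ε x₀ σI σII n ω)) ω) := by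
    intro n ω
    have hmem := mem_inPlay_succ γ a D ε x₀ σI σII n ω
    rw [← hA] at hmem
    simp only [S]
    by_cases hω : ω ∈ A n
    · by_cases ht : ((ω n).2.2 : ℝ) ≤ scaledDist D ε (process γ a ε x₀ σI σII n ω)
      · simp [hmem.2 ⟨hω, ht⟩, hω, turnOutcome, ht]
      -- The game stops on this turn: the payoff is read at the old position, as in `turnOutcome`.
      · have hpay := payoff_eq γ a D ε x₀ σI σII F hω (not_le.1 ht)
        rw [← hP] at hpay
        have hn : ω ∉ A (n + 1) := fun h => ht (hmem.1 h).2
        simp [hn, hω, turnOutcome, ht, hpay]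
    · have hn : ω ∉ A (n + 1) := fun h => hω (hmem.1 h).1
      simp [hn, hω]
  have hmono : ∀ n, ∫ ω, S n ω ∂gameLaw N ≤ ∫ ω, S (n + 1) ω ∂gameLaw N := by
    intro n
    simp only [hstep]
    rw [integral_add (hSi n) (by exact ((hto n).indicator (hm n)).sub ((hvi n).indicator (hm n))),
      integral_sub ((hto n).indicator (hm n)) ((hvi n).indicator (hm n)),
      integral_inPlay_turnOutcome γ a D x₀ σI σII hε hv.measurable hF hC hC' n]
    have := integral_mono ((hvi n).indicator (hm n)) ((htv n).indicator (hm n))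
      fun ω => indicator_le_indicator (hle n (gameHistory γ a ε x₀ σI σII ω n))
    linarith
  have hS0 : ∫ ω, S 0 ω ∂gameLaw N = v x₀ := by
    have : A 0 = univ := by ext; simp [hA, inPlay]
    simp [S, this, process, gameHistory, History.position]
  have hlow : ∀ n, v x₀ ≤ ∫ ω, S n ω ∂gameLaw N := by
    intro n
    induction n with
    | zero => exact hS0.ge
    | succ n ih => exact ih.trans (hmono n)
  have hup : ∀ n, ∫ ω, S n ω ∂gameLaw N ≤
      expectedPayoff γ a D F ε x₀ σI σII + (C + C') * (gameLaw N).real (A n) := by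
    intro n
    have hb : ∀ ω, S n ω ≤ P ω + (A n).indicator (fun _ => C + C') ω := by
      intro ω
      refine add_le_add_right (indicator_le_indicator ?_) _
      have h1 := (abs_le.1 (hC (process γ a ε x₀ σI σII n ω))).2
      have h2 : -C' ≤ P ω := (abs_le.1 (hC' _)).1
      linarith
    have hci : Integrable ((A n).indicator fun _ => C + C') (gameLaw N) :=
      (integrable_const _).indicator (hm n)
    refine (integral_mono (hSi n) (hPi.add hci) hb).trans_eq ?_
    simp only [Pi.add_apply]
    rw [integral_add hPi hci, integral_indicator_const _ (hm n), smul_eq_mul, mul_comm]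
    rfl
  have hlim : Filter.Tendsto (fun n => expectedPayoff γ a D F ε x₀ σI σII +
      (C + C') * (gameLaw N).real (A n)) Filter.atTop
      (nhds (expectedPayoff γ a D F ε x₀ σI σII)) := by
    simpa using ((tendsto_measureReal_inPlay x₀ σI σII hε hφ).const_mul (C + C')).const_add
      (expectedPayoff γ a D F ε x₀ σI σII)
  exact ge_of_tendsto' hlim fun n => (hlow n).trans (hup n)

end Stopping

/-! ### Almost optimal stationary strategies -/

/-- The supremum over the open ball need not be attained. The first member of a dense sequence
within `ζ` of it is a measurable choice, since being within `ζ` is an open condition on `x`. -/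
theorem exists_measurable_almost_maximizer {N : ℕ} (γ a ε : ℝ) {u : Space N → ℝ}
    (hu : Continuous u) {C : ℝ} (hC : ∀ x, |u x| ≤ C) {ζ : ℝ} (hζ : 0 < ζ) :
    ∃ s : Space N → UnitBall N, Measurable s ∧ ∀ x,
      (⨆ y : UnitBall N, noiseAverage γ a ε u y x) - ζ ≤ noiseAverage γ a ε u (s x) x := by
  classical
  have hc := continuous_noiseAverage γ a ε hu hC
  let y : ℕ → UnitBall N := TopologicalSpace.denseSeq (UnitBall N)
  let p : Space N → ℕ → Prop := fun x k =>
    (⨆ y : UnitBall N, noiseAverage γ a ε u y x) - ζ < noiseAverage γ a ε u (y k) x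
  have hp : ∀ x, ∃ k, p x k := by
    intro x
    obtain ⟨z, hz⟩ := exists_lt_of_lt_ciSup (sub_lt_self
      (⨆ y : UnitBall N, noiseAverage γ a ε u y x) hζ)
    have hcx : Continuous fun z : UnitBall N => noiseAverage γ a ε u z x :=
      hc.comp (continuous_subtype_val.prodMk continuous_const)
    exact (TopologicalSpace.denseRange_denseSeq (UnitBall N)).exists_mem_open
      (isOpen_lt continuous_const hcx) ⟨z, hz⟩
  refine ⟨fun x => y (Nat.find (hp x)), ?_, fun x => (Nat.find_spec (hp x)).le⟩
  refine (measurable_from_nat (f := y)).comp (measurable_find hp fun k => ?_)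
  exact (isOpen_lt ((continuous_iSup_noiseAverage γ a ε hu hC).sub continuous_const)
    (hc.comp (continuous_const.prodMk continuous_id))).measurableSet

/-- The strategy that depends on the current position only. -/
def Strategy.stationary {N : ℕ} (s : Space N → UnitBall N) (hs : Measurable s) : Strategy N where
  toFun _ h := s h.position
  measurable_toFun _ := hs.comp measurable_position

section Value

variable {N : ℕ} {γ a ε κ M : ℝ} {D : Set (Space N)} {φ F u : Space N → ℝ}

theorem averageOp_neg (hγ : 0 < γ) (ha : 0 < a) (hε : 0 < ε) (u : Space N → ℝ) (x : Space N) :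
    averageOp γ a ε (fun z => -u z) x = -averageOp γ a ε u x := by
  rw [averageOp_eq hγ ha hε, averageOp_eq hγ ha hε, iInf_noiseAverage_eq, iInf_noiseAverage_eq]
  simp only [neg_neg]
  ring

/-- Changing signs exchanges the players, so the lower estimates for one serve the other. -/
theorem IsDPPSolution.neg (hγ : 0 < γ) (ha : 0 < a) (hε : 0 < ε)
    (hu : IsDPPSolution γ a D F ε u) :
    IsDPPSolution γ a D (fun x => -F x) ε (fun x => -u x) where
  measurable := hu.measurable.neg
  bounded := by simpa using hu.bounded
  dpp x := by
    rw [averageOp_neg hγ ha hε, hu.dpp x]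
    ring

/-- If one of the players almost maximises the average of a solution, the solution is, up to a
small multiple of the weight, at most its expected value after the next turn. -/
theorem IsDPPSolution.sub_le_turnValue (hγ : 0 < γ) (ha : 0 < a) (hε : 0 < ε)
    (hφ : IsDecreasingWeight γ a ε D κ M φ) (hu : IsDPPSolution γ a D F ε u) {η : ℝ}
    (hη : 0 < η) {σI σII : Strategy N} {n : ℕ} {h : History N n}
    (hσ : (⨆ y : UnitBall N, noiseAverage γ a ε u y h.position) - η * (1 - κ) ≤
        noiseAverage γ a ε u (σI.toFun n h) h.position ∨
      (⨆ y : UnitBall N, noiseAverage γ a ε u y h.position) - η * (1 - κ) ≤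
        noiseAverage γ a ε u (σII.toFun n h) h.position) :
    u h.position + -η * φ h.position ≤
      turnValue γ a D ε σI σII (fun z => u z + -η * φ z) F h := by
  obtain ⟨C, hC⟩ := hu.bounded
  set x := h.position
  have hφ1 := hφ.one_le x
  rw [turnValue, hu.dpp x]
  by_cases hx : x ∈ D
  · rw [noiseAverage_add_mul γ a ε hu.measurable hφ.continuous.measurable hC hφ.abs_le,
      noiseAverage_add_mul γ a ε hu.measurable hφ.continuous.measurable hC hφ.abs_le,
      averageOp_eq hγ ha hε]
    set y₁ := σI.toFun n h
    set y₂ := σII.toFun n h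
    have hinf := ciInf_le (bddBelow_noiseAverage γ a ε hC x)
    have hw := fun y => mul_le_mul_of_nonneg_left (hφ.noiseAverage_le x hx y) hη.le
    -- The loss `η (1 - κ)` of an inexact maximiser is covered by the average decrease of `η φ`,
    -- which is at least `η (1 - κ) φ`.
    have hκ : η * (1 - κ) ≤ η * (1 - κ) * φ x :=
      le_mul_of_one_le_right (mul_nonneg hη.le (sub_nonneg.2 hφ.rate_lt_one.le)) hφ1
    have hgap : 0 ≤ η * (1 - κ) := mul_nonneg hη.le (sub_nonneg.2 hφ.rate_lt_one.le)
    -- One player comes close to the supremum; the other cannot get below the infimum.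
    have key : 1 / 2 * ((⨅ y : UnitBall N, noiseAverage γ a ε u y x) +
        ⨆ y : UnitBall N, noiseAverage γ a ε u y x) - η * φ x ≤
        1 / 2 * (noiseAverage γ a ε u y₁ x + -η * noiseAverage γ a ε φ y₁ x +
          (noiseAverage γ a ε u y₂ x + -η * noiseAverage γ a ε φ y₂ x)) := by
      have h1 := hw y₁
      have h2 := hw y₂
      have h3 := hinf y₁
      have h4 := hinf y₂
      rcases hσ with hσ | hσ <;> nlinarith
    have h0 := scaledDist_nonneg D hε x
    have h1 := scaledDist_le_one D hε x
    have hmul := mul_le_mul_of_nonneg_left key h0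
    have : scaledDist D ε x * (η * φ x) ≤ η * φ x :=
      mul_le_of_le_one_left (by positivity) h1
    linarith
  · rw [scaledDist_eq_zero hε hx]
    have : 0 ≤ η * φ x := by positivity
    linarith

theorem IsDPPSolution.sub_le_expectedPayoff (hγ : 0 < γ) (ha : 0 < a) (hε : 0 < ε)
    (hφ : IsDecreasingWeight γ a ε D κ M φ) (hF : Continuous F) (hFb : ∃ C, ∀ x, |F x| ≤ C)
    (hu : IsDPPSolution γ a D F ε u) (huc : Continuous u) {η : ℝ} (hη : 0 < η)
    {σI σII : Strategy N}
    (hσ : ∀ (n : ℕ) (h : History N n),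
      (⨆ y : UnitBall N, noiseAverage γ a ε u y h.position) - η * (1 - κ) ≤
        noiseAverage γ a ε u (σI.toFun n h) h.position ∨
      (⨆ y : UnitBall N, noiseAverage γ a ε u y h.position) - η * (1 - κ) ≤
        noiseAverage γ a ε u (σII.toFun n h) h.position) (x : Space N) :
    u x - η * M ≤ expectedPayoff γ a D F ε x σI σII := by
  obtain ⟨C, hC⟩ := hu.bounded
  obtain ⟨C', hC'⟩ := hFb
  have hb : ∀ z, |u z + -η * φ z| ≤ C + η * M := fun z => by
    refine (abs_add_le _ _).trans (add_le_add (hC z) ?_)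
    rw [abs_mul, abs_neg, abs_of_pos hη]
    exact mul_le_mul_of_nonneg_left (hφ.abs_le z) hη.le
  have := le_expectedPayoff x σI σII hε hφ hF.measurable
    (v := fun z => u z + -η * φ z) (huc.add (continuous_const.mul hφ.continuous)) hb hC'
    fun n h => hu.sub_le_turnValue hγ ha hε hφ hη (hσ n h)
  have hM := mul_le_mul_of_nonneg_left (hφ.le_bound x) hη.le
  linarith

theorem IsDPPSolution.exists_strategyI (hγ : 0 < γ) (ha : 0 < a) (hε : 0 < ε)
    (hφ : IsDecreasingWeight γ a ε D κ M φ) (hF : Continuous F) (hFb : ∃ C, ∀ x, |F x| ≤ C)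
    (hu : IsDPPSolution γ a D F ε u) (huc : Continuous u) {η : ℝ} (hη : 0 < η) :
    ∃ σI : Strategy N, ∀ (σII : Strategy N) (x : Space N),
      u x - η ≤ expectedPayoff γ a D F ε x σI σII := by
  obtain ⟨C, hC⟩ := hu.bounded
  have hM : 0 < M := zero_lt_one.trans_le ((hφ.one_le 0).trans (hφ.le_bound 0))
  -- The weight costs up to `M` times its coefficient, so the coefficient is `η / M`.
  obtain ⟨s, hs, hmax⟩ := exists_measurable_almost_maximizer γ a ε huc hC
    (mul_pos (div_pos hη hM) (sub_pos.2 hφ.rate_lt_one))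
  refine ⟨.stationary s hs, fun σII x => ?_⟩
  have := hu.sub_le_expectedPayoff hγ ha hε hφ hF hFb huc (div_pos hη hM)
    (σI := .stationary s hs) (σII := σII) (fun n h => .inl (hmax _)) x
  rwa [div_mul_cancel₀ _ hM.ne'] at this

theorem IsDPPSolution.exists_strategyII (hγ : 0 < γ) (ha : 0 < a) (hε : 0 < ε)
    (hφ : IsDecreasingWeight γ a ε D κ M φ) (hF : Continuous F) (hFb : ∃ C, ∀ x, |F x| ≤ C)
    (hu : IsDPPSolution γ a D F ε u) (huc : Continuous u) {η : ℝ} (hη : 0 < η) :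
    ∃ σII : Strategy N, ∀ (σI : Strategy N) (x : Space N),
      expectedPayoff γ a D F ε x σI σII ≤ u x + η := by
  obtain ⟨C, hC⟩ := hu.bounded
  have hM : 0 < M := zero_lt_one.trans_le ((hφ.one_le 0).trans (hφ.le_bound 0))
  obtain ⟨s, hs, hmax⟩ := exists_measurable_almost_maximizer γ a ε huc.neg (C := C)
    (by simpa using hC) (mul_pos (div_pos hη hM) (sub_pos.2 hφ.rate_lt_one))
  refine ⟨.stationary s hs, fun σI x => ?_⟩
  -- Player II minimises `u` by maximising `-u` in the game with payoff `-F`.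
  have h := (hu.neg hγ ha hε).sub_le_expectedPayoff hγ ha hε hφ hF.neg (by simpa using hFb)
    huc.neg (div_pos hη hM) (σI := σI) (σII := .stationary s hs) (fun n h => .inr (hmax _)) x
  have hneg : expectedPayoff γ a D (-F) ε x σI (.stationary s hs) =
      -expectedPayoff γ a D F ε x σI (.stationary s hs) := integral_neg _
  rw [div_mul_cancel₀ _ hM.ne', hneg] at h
  linarith

/-- The almost optimal strategies work against every opponent, so they squeeze both values against
the general inequality `sup inf ≤ inf sup`. -/
theorem IsDPPSolution.value_eq (hγ : 0 < γ) (ha : 0 < a) (hε : 0 < ε)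
    (hφ : IsDecreasingWeight γ a ε D κ M φ) (hF : Continuous F) (hFb : ∃ C, ∀ x, |F x| ≤ C)
    (hu : IsDPPSolution γ a D F ε u) (huc : Continuous u) (x : Space N) :
    valueI γ a D F ε x = (u x : EReal) ∧ valueII γ a D F ε x = (u x : EReal) := by
  have hle : valueI γ a D F ε x ≤ valueII γ a D F ε x := iSup_iInf_le_iInf_iSup _
  have hI : (u x : EReal) ≤ valueI γ a D F ε x := by
    refine EReal.ge_of_forall_gt_iff_ge.1 fun z hz => ?_
    obtain ⟨σI, hσ⟩ := hu.exists_strategyI hγ ha hε hφ hF hFb huc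
      (sub_pos.2 (EReal.coe_lt_coe_iff.1 hz))
    refine le_iSup_of_le σI (le_iInf fun σII => EReal.coe_le_coe_iff.2 ?_)
    simpa using hσ σII x
  have hII : valueII γ a D F ε x ≤ (u x : EReal) := by
    refine EReal.le_of_forall_lt_iff_le.1 fun z hz => ?_
    obtain ⟨σII, hσ⟩ := hu.exists_strategyII hγ ha hε hφ hF hFb huc
      (sub_pos.2 (EReal.coe_lt_coe_iff.1 hz))
    refine iInf_le_of_le σII (iSup_le fun σI => EReal.coe_le_coe_iff.2 ?_)
    simpa using hσ σI x
  exact ⟨le_antisymm (hle.trans hII) hI, le_antisymm hII (hI.trans hle)⟩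

end Value

end TugOfWar

theorem theorem4p2 (N : ℕ) (hN : 1 ≤ N) (p γ a : ℝ) (hp : 1 < p) (hγ : 0 < γ) (ha : 0 < a)
    (hprope : (N + 2) / γ ^ 2 + a ^ 2 = p - 1)
    (hprope2 : (a ≤ 1 ∧ 1 < γ * a) ∨ (1 ≤ a ∧ 1 < γ))
    (D : Set (TugOfWar.Space N)) (hDo : IsOpen D) (hDb : Bornology.IsBounded D)
    (hDc : IsConnected D)
    (F : TugOfWar.Space N → ℝ) (hFc : Continuous F) (hFb : ∃ C : ℝ, ∀ x, |F x| ≤ C)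
    (ε : ℝ) (hε : ε ∈ Set.Ioo (0 : ℝ) 1) :
    (∀ (x₀ : TugOfWar.Space N) (σI σII : TugOfWar.Strategy N),
      (∀ᵐ ω ∂(TugOfWar.gameLaw N), TugOfWar.stoppingTime γ a D ε x₀ σI σII ω < ⊤) ∧
      MeasureTheory.Integrable (TugOfWar.payoff γ a D F ε x₀ σI σII) (TugOfWar.gameLaw N)) ∧
    ∃ u : TugOfWar.Space N → ℝ,
      TugOfWar.IsDPPSolution γ a D F ε u ∧
      (∀ v, TugOfWar.IsDPPSolution γ a D F ε v → v = u) ∧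
      Continuous u ∧
      ∀ x, TugOfWar.valueI γ a D F ε x = (u x : EReal) ∧
        TugOfWar.valueII γ a D F ε x = (u x : EReal) := by
  obtain ⟨κ, M, φ, hφ⟩ := TugOfWar.exists_isDecreasingWeight hN hγ hprope2 hε.1 hDb
  refine ⟨fun x₀ σI σII => ⟨TugOfWar.ae_stoppingTime_lt_top x₀ σI σII hε.1 hφ, ?_⟩, ?_⟩
  · obtain ⟨C, hC⟩ := hFb
    exact TugOfWar.integrable_payoff γ a D ε x₀ σI σII hFc.measurable hC
  · obtain ⟨u, hu, huc⟩ := TugOfWar.exists_isDPPSolution hγ ha hε.1 hφ hFc hFb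
    exact ⟨u, hu, fun v hv => hu.unique hγ ha hε.1 hφ hv, huc,
      hu.value_eq hγ ha hε.1 hφ hFc hFb huc⟩
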